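/- Let $\Omega\subset\mathbb{R}^p$ be open and let $P:\Omega\to\mathbb{R}^{n\times n}$ be twice continuously differentiable with $P(\eta)$ symmetric positive definite for every $\eta\in\Omega$. Consider the linear regression $y(t)=\phi(t)^T\theta_0+v(t)$, $t=1,2,\dots$, where $\theta_0\in\mathbb{R}^n$, the noise terms $v(t)$ are i.i.d. $\mathcal N(0,\sigma^2)$ with $\sigma>0$, and the (deterministic or random) regressors $\phi(t)\in\mathbb{R}^n$ are independent of the noise. For the first $N$ observations write $Y=\Phi\theta_0+V$, where $\Phi$ has rows $\phi(1)^T,\dots,\phi(N)^T$, and assume that $\Phi^T\Phi/N\to\Sigma$ almost surely as $N\to\infty$, with $\Sigma$ positive definite. Put $$\mathcal F_{\rm EB}(\eta)=Y^TQ^{-1}Y+\log\det Q,\quad Q=\Phi P(\eta)\Phi^T+\sigma^2I_N,\qquad W_b(\eta)=\theta_0^TP(\eta)^{-1}\theta_0+\log\det P(\eta).$$ Let $\hat\eta_{\rm EB}=\hat\eta_{{\rm EB},N}$ be random vectors such that, almost surely, for all large $N$, $\hat\eta_{{\rm EB},N}$ is a global minimizer of $\mathcal F_{\rm EB}$ over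 $\Omega$. Assume that the estimates stay in the interior of $\Omega$ uniformly in $N$: almost surely there is a compact set $K\subset\Omega$ with $\hat\eta_{{\rm EB},N}\in K$ for all large $N$. Assume that the set of global minimizers of $W_b$ over $\Omega$ consists of isolated points, and let $\eta_b^*$ be one of them; if there are several, suppose that $\eta_b^*$ is the one associated with the estimates, i.e. almost surely, for all large $N$, no other global minimizer of $W_b$ is closer to $\hat\eta_{{\rm EB},N}$ than $\eta_b^*$. Let $A_b$ and $B_b$ be the $p\times p$ matrices with entries $$(A_b)_{k,l}=\Big\{\theta_0^T\frac{\partial^2P^{-1}}{\partial\eta_k\partial\eta_l}\theta_0+\mathrm{Tr}\Big(\frac{\partial P^{-1}}{\partial\eta_l}\frac{\partial P}{\partial\eta_k}\Big)+\mathrm{Tr}\Big(P^{-1}\frac{\partial^2P}{\partial\eta_k\partial\eta_l}\Big)\Big\}\Big|_{\eta_b^*},\qquad (B_b)_{k,l}=4\sigma^2\,\theta_0^T\frac{\partial P^{-1}}{\partial\eta_k}\Sigma^{-1}\frac{\partial P^{-1}}{\partial\eta_l}\theta_0\Big|_{\eta_b^*},$$ and assume that $A_b$ is invertible. Then $A_b$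 is the Hessian of $W_b$ at $\eta_b^*$, the matrix $A_b^{-1}B_bA_b^{-1}$ is positive semidefinite, and, as $N\to\infty$, $$\sqrt N\,(\hat\eta_{\rm EB}-\eta_b^*)\ \xrightarrow{d}\ \mathcal N\big(0,\;A_b^{-1}B_bA_b^{-1}\big).$$ -/

import Mathlib

open MeasureTheory ProbabilityTheory Filter Topology Matrix

noncomputable section

namespace EmpiricalBayes

/-- The regression matrix `Φ`, whose rows are the first `N` regressors. -/
def regressionMatrix {n : ℕ} (φ : ℕ → Fin n → ℝ) (N : ℕ) : Matrix (Fin N) (Fin n) ℝ :=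
  Matrix.of fun t i => φ t i

/-- The output vector `Y = Φ θ₀ + V`, where `V` collects the first `N` noise terms. -/
def outputVector {n : ℕ} (θ₀ : Fin n → ℝ) (φ : ℕ → Fin n → ℝ) (v : ℕ → ℝ) (N : ℕ) :
    Fin N → ℝ :=
  fun t => (regressionMatrix φ N *ᵥ θ₀) t + v t

/-- `Q = Φ P Φᵀ + σ² I_N`. -/
def outputCov {n N : ℕ} (σ : ℝ) (Φ : Matrix (Fin N) (Fin n) ℝ) (P : Matrix (Fin n) (Fin n) ℝ) :
    Matrix (Fin N) (Fin N) ℝ :=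
  Φ * P * Φᵀ + σ ^ 2 • (1 : Matrix (Fin N) (Fin N) ℝ)

/-- The empirical Bayes cost `Yᵀ Q⁻¹ Y + log det Q`. -/
def costEB {n N : ℕ} (σ : ℝ) (Φ : Matrix (Fin N) (Fin n) ℝ) (Y : Fin N → ℝ)
    (P : Matrix (Fin n) (Fin n) ℝ) : ℝ :=
  Y ⬝ᵥ ((outputCov σ Φ P)⁻¹ *ᵥ Y) + Real.log (outputCov σ Φ P).det

/-- The limit cost `W_b = θ₀ᵀ P⁻¹ θ₀ + log det P`. -/
def limitCost {n : ℕ} (θ₀ : Fin n → ℝ) (P : Matrix (Fin n) (Fin n) ℝ) : ℝ :=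
  θ₀ ⬝ᵥ (P⁻¹ *ᵥ θ₀) + Real.log P.det

/-- The set of global minimizers of `f` over `Ω`. -/
def argminSet {E : Type*} (f : E → ℝ) (Ω : Set E) : Set E :=
  {η | η ∈ Ω ∧ ∀ η' ∈ Ω, f η ≤ f η'}

/-- The partial derivative `∂f/∂η_k`. -/
def partialDeriv {p : ℕ} (k : Fin p) (f : EuclideanSpace ℝ (Fin p) → ℝ)
    (η : EuclideanSpace ℝ (Fin p)) : ℝ :=
  fderiv ℝ f η (EuclideanSpace.single k 1)

/-- The entrywise partial derivative `∂M/∂η_k` of a matrix function. -/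
def matPartialDeriv {p n : ℕ} (k : Fin p)
    (M : EuclideanSpace ℝ (Fin p) → Matrix (Fin n) (Fin n) ℝ)
    (η : EuclideanSpace ℝ (Fin p)) : Matrix (Fin n) (Fin n) ℝ :=
  Matrix.of fun i j => partialDeriv k (fun η' => M η' i j) η

/-- The matrix `A_b(η)`, with entries
`θ₀ᵀ (∂²P⁻¹/∂η_k∂η_l) θ₀ + Tr (∂P⁻¹/∂η_l ∂P/∂η_k) + Tr (P⁻¹ ∂²P/∂η_k∂η_l)`. -/
def matA {p n : ℕ} (θ₀ : Fin n → ℝ)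
    (P : EuclideanSpace ℝ (Fin p) → Matrix (Fin n) (Fin n) ℝ)
    (η : EuclideanSpace ℝ (Fin p)) : Matrix (Fin p) (Fin p) ℝ :=
  Matrix.of fun k l =>
    θ₀ ⬝ᵥ (matPartialDeriv k (matPartialDeriv l fun η' => (P η')⁻¹) η *ᵥ θ₀)
      + (matPartialDeriv l (fun η' => (P η')⁻¹) η * matPartialDeriv k P η).trace
      + ((P η)⁻¹ * matPartialDeriv k (matPartialDeriv l P) η).trace

/-- The matrix `B_b(η)`, with entries `4 σ² θ₀ᵀ (∂P⁻¹/∂η_k) Σ⁻¹ (∂P⁻¹/∂η_l) θ₀`. -/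
def matB {p n : ℕ} (σ : ℝ) (S : Matrix (Fin n) (Fin n) ℝ) (θ₀ : Fin n → ℝ)
    (P : EuclideanSpace ℝ (Fin p) → Matrix (Fin n) (Fin n) ℝ)
    (η : EuclideanSpace ℝ (Fin p)) : Matrix (Fin p) (Fin p) ℝ :=
  Matrix.of fun k l =>
    4 * σ ^ 2 *
      (θ₀ ⬝ᵥ ((matPartialDeriv k (fun η' => (P η')⁻¹) η * S⁻¹
        * matPartialDeriv l (fun η' => (P η')⁻¹) η) *ᵥ θ₀))

end EmpiricalBayes

end

/-!
Write `G = ΦᵀΦ`. When `G` is invertible, the output precision matrix `Q⁻¹` splits, and up to a term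
not depending on `η` the empirical Bayes cost is the limit cost in which `θ₀` is replaced by the
least squares estimate `θ₀ + G⁻¹ΦᵀV` and `P η` by `P η + σ² G⁻¹` (`costEB_eq`). The estimate thus
minimizes a perturbation `perturbedCost P (x, ·)` of `W_b`, where `x = (θ, E)` tends to `(θ₀, 0)`.

*Pathwise part* (`tendsto_linearization`). Every limit point of the estimates minimizes `W_b`, so by
the choice of `ηb` they converge to `ηb` (`tendsto_argmin`). Their first-order condition is a root of
the score, which is differentiable at `((θ₀, 0), ηb)` with derivative the Hessian `A_b` in `η`
and the matrix `D` with rows `2 (∂P⁻¹/∂η_k) θ₀` in `θ` (`exists_hasFDerivAt_score`). Since `A_b` is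
invertible, the estimation error is `-A_b⁻¹ D G⁻¹ΦᵀV` up to an error of smaller order; the
perturbation `E = σ² G⁻¹` is of order `1 / N` and does not contribute at the scale `1 / √N`.

*Probabilistic part.* Conditionally on the regressors, `√N G⁻¹ΦᵀV` is Gaussian with covariance
`σ² (G / N)⁻¹`, which tends to `σ² Σ⁻¹`; dominated convergence of the characteristic functions and
Lévy's theorem give the asymptotic normality of its linear images
(`tendstoInDistribution_scaledLSError`). No strong consistency of least squares is needed: the
pathwise expansion is used only along the indices at which `√N G⁻¹ΦᵀV` stays bounded, and
tightness of that sequence turns it into an error that tends to `0` in probability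
(`tendstoInMeasure_of_isTight`). Finally `A_b⁻¹ D (σ² Σ⁻¹) Dᵀ A_b⁻¹ = A_b⁻¹ B_b A_b⁻¹`
(`sensitivity_covariance`).
-/

noncomputable section

namespace EmpiricalBayes

/-! ### Smoothness of determinants and inverses, and Jacobi's formula -/

section MatrixCalculus

variable {F : Type*} [NormedAddCommGroup F] [NormedSpace ℝ F] {n p : ℕ}

theorem contDiffAt_det {m : WithTop ℕ∞} {ι : Type*} [Fintype ι] [DecidableEq ι]
    {M : F → Matrix ι ι ℝ} {x : F}
    (hM : ∀ i j, ContDiffAt ℝ m (fun y => M y i j) x) :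
    ContDiffAt ℝ m (fun y => (M y).det) x := by
  simp only [Matrix.det_apply]
  exact ContDiffAt.sum fun s _ => (contDiffAt_prod fun i _ => hM _ _).const_smul _

theorem contDiffAt_inv_apply {m : WithTop ℕ∞} {M : F → Matrix (Fin n) (Fin n) ℝ} {x : F}
    (hM : ∀ i j, ContDiffAt ℝ m (fun y => M y i j) x) (hx : (M x).det ≠ 0) (i j : Fin n) :
    ContDiffAt ℝ m (fun y => (M y)⁻¹ i j) x := by
  have h : (fun y => (M y)⁻¹ i j) = fun y => (M y).det⁻¹ * ((M y).updateRow j (Pi.single i 1)).det := by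
    funext y
    simp [Matrix.inv_def, Matrix.adjugate_apply]
  rw [h]
  refine ((contDiffAt_det hM).inv hx).mul (contDiffAt_det fun a b => ?_)
  by_cases hj : a = j
  · subst hj; simpa using contDiffAt_const
  · simpa [Matrix.updateRow_ne hj] using hM a b

theorem contDiffAt_limitCost {m : WithTop ℕ∞} {θ : F → Fin n → ℝ}
    {M : F → Matrix (Fin n) (Fin n) ℝ} {x : F} (hθ : ∀ i, ContDiffAt ℝ m (fun y => θ y i) x)
    (hM : ∀ i j, ContDiffAt ℝ m (fun y => M y i j) x) (hx : (M x).det ≠ 0) :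
    ContDiffAt ℝ m (fun y => limitCost (θ y) (M y)) x := by
  unfold limitCost
  simp only [dotProduct, mulVec]
  exact (ContDiffAt.sum fun i _ => (hθ i).mul
    (ContDiffAt.sum fun j _ => (contDiffAt_inv_apply hM hx i j).mul (hθ j))).add
    ((contDiffAt_det hM).log hx)

/-- **Jacobi's formula** for the logarithmic derivative of a determinant. -/
theorem hasFDerivAt_log_det {M : F → Matrix (Fin n) (Fin n) ℝ} {M' : Fin n → Fin n → F →L[ℝ] ℝ}
    {x : F} (hM : ∀ i j, HasFDerivAt (fun y => M y i j) (M' i j) x) (hx : (M x).det ≠ 0) :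
    HasFDerivAt (fun y => Real.log (M y).det) (∑ i, ∑ j, (M x)⁻¹ j i • M' i j) x := by
  let D : ContinuousMultilinearMap ℝ (fun _ : Fin n => Fin n → ℝ) ℝ :=
    { (Matrix.detRowAlternating (R := ℝ) (n := Fin n)).toMultilinearMap with
      cont := (Continuous.matrix_det continuous_id :
        Continuous fun M : Matrix (Fin n) (Fin n) ℝ => M.det) }
  have h1 : HasFDerivAt (fun y => (fun i j => M y i j : Fin n → Fin n → ℝ))
      (ContinuousLinearMap.pi fun i => ContinuousLinearMap.pi fun j => M' i j) x :=
    hasFDerivAt_pi.2 fun i => hasFDerivAt_pi.2 fun j => hM i j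
  have h2 := (D.hasFDerivAt (fun i j => M x i j)).comp x h1
  have h3 := HasFDerivAt.log (f := fun y => (M y).det) h2 hx
  convert h3 using 1
  ext y
  simp only [_root_.sum_apply, _root_.smul_apply, smul_eq_mul,
    ContinuousLinearMap.comp_apply, ContinuousMultilinearMap.linearDeriv_apply, Finset.mul_sum]
  refine Finset.sum_congr rfl fun i _ => ?_
  have h4 : D (Function.update (fun i j => M x i j) i (fun j => M' i j y))
      = ((M x).updateRow i (fun j => M' i j y)).det := rfl
  have h5 : (ContinuousLinearMap.pi fun i => ContinuousLinearMap.pi fun j => M' i j) y i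
      = fun j => M' i j y := rfl
  rw [h5, h4, ← Matrix.cramer_transpose_apply, Matrix.cramer_eq_adjugate_mulVec,
    ← Matrix.adjugate_transpose]
  simp [Matrix.inv_def, mulVec, dotProduct, Finset.mul_sum, mul_assoc]

end MatrixCalculus

/-! ### Partial derivatives and the Hessian of the limit cost -/

section PartialDerivatives

variable {n p : ℕ} {η : EuclideanSpace ℝ (Fin p)}

theorem contDiffAt_partialDeriv {f : EuclideanSpace ℝ (Fin p) → ℝ} (k : Fin p)
    (hf : ContDiffAt ℝ 2 f η) : ContDiffAt ℝ 1 (partialDeriv k f) η :=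
  (hf.fderiv_right (m := 1) (by norm_num)).clm_apply contDiffAt_const

theorem partialDeriv_comm {f : EuclideanSpace ℝ (Fin p) → ℝ} (hf : ContDiffAt ℝ 2 f η)
    (k l : Fin p) :
    partialDeriv k (partialDeriv l f) η = partialDeriv l (partialDeriv k f) η := by
  have hd : DifferentiableAt ℝ (fderiv ℝ f) η :=
    (hf.fderiv_right (m := 1) (by norm_num)).differentiableAt (by norm_num)
  have key : ∀ k l : Fin p, partialDeriv k (partialDeriv l f) η
      = fderiv ℝ (fderiv ℝ f) η (EuclideanSpace.single k 1) (EuclideanSpace.single l 1) := by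
    intro k l
    have := (hd.hasFDerivAt.clm_apply (hasFDerivAt_const (EuclideanSpace.single l (1 : ℝ)) η)).fderiv
    unfold partialDeriv
    rw [this]
    simp
  rw [key, key]
  exact (hf.isSymmSndFDerivAt (by simp)).eq _ _

theorem partialDeriv_congr {f g : EuclideanSpace ℝ (Fin p) → ℝ} (k : Fin p) (h : f =ᶠ[𝓝 η] g) :
    partialDeriv k f η = partialDeriv k g η := by
  unfold partialDeriv
  rw [h.fderiv_eq]

theorem partialDeriv_add {f g : EuclideanSpace ℝ (Fin p) → ℝ} (k : Fin p)
    (hf : DifferentiableAt ℝ f η) (hg : DifferentiableAt ℝ g η) :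
    partialDeriv k (fun y => f y + g y) η = partialDeriv k f η + partialDeriv k g η := by
  unfold partialDeriv
  rw [fderiv_fun_add hf hg]
  simp

theorem partialDeriv_mul {f g : EuclideanSpace ℝ (Fin p) → ℝ} (k : Fin p)
    (hf : DifferentiableAt ℝ f η) (hg : DifferentiableAt ℝ g η) :
    partialDeriv k (fun y => f y * g y) η
      = partialDeriv k f η * g η + f η * partialDeriv k g η := by
  unfold partialDeriv
  rw [fderiv_fun_mul hf hg]
  simp; ring

theorem partialDeriv_sum {ι : Type*} {s : Finset ι} {f : ι → EuclideanSpace ℝ (Fin p) → ℝ}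
    (k : Fin p) (hf : ∀ i ∈ s, DifferentiableAt ℝ (f i) η) :
    partialDeriv k (fun y => ∑ i ∈ s, f i y) η = ∑ i ∈ s, partialDeriv k (f i) η := by
  unfold partialDeriv
  rw [fderiv_fun_sum hf]
  simp

theorem partialDeriv_quadForm {M : EuclideanSpace ℝ (Fin p) → Matrix (Fin n) (Fin n) ℝ}
    (hM : ∀ i j, DifferentiableAt ℝ (fun y => M y i j) η) (θ : Fin n → ℝ) (k : Fin p) :
    partialDeriv k (fun y => θ ⬝ᵥ (M y *ᵥ θ)) η = θ ⬝ᵥ (matPartialDeriv k M η *ᵥ θ) := by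
  unfold partialDeriv
  have : HasFDerivAt (fun y => θ ⬝ᵥ (M y *ᵥ θ))
      (∑ i, θ i • ∑ j, θ j • fderiv ℝ (fun y => M y i j) η) η := by
    simp only [dotProduct, mulVec]
    exact HasFDerivAt.fun_sum fun i _ => (HasFDerivAt.fun_sum fun j _ =>
      (hM i j).hasFDerivAt.mul_const (θ j)).const_mul (θ i)
  rw [this.fderiv]
  simp [dotProduct, mulVec, matPartialDeriv, partialDeriv, mul_comm]

theorem partialDeriv_trace_mul {M R : EuclideanSpace ℝ (Fin p) → Matrix (Fin n) (Fin n) ℝ}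
    (hM : ∀ i j, DifferentiableAt ℝ (fun y => M y i j) η)
    (hR : ∀ i j, DifferentiableAt ℝ (fun y => R y i j) η) (k : Fin p) :
    partialDeriv k (fun y => (M y * R y).trace) η
      = (matPartialDeriv k M η * R η).trace + (M η * matPartialDeriv k R η).trace := by
  simp only [Matrix.trace, Matrix.diag, Matrix.mul_apply]
  rw [partialDeriv_sum k fun i _ => DifferentiableAt.fun_sum fun j _ => (hM i j).fun_mul (hR j i)]
  rw [← Finset.sum_add_distrib]
  refine Finset.sum_congr rfl fun i _ => ?_
  rw [partialDeriv_sum k fun j _ => (hM i j).fun_mul (hR j i), ← Finset.sum_add_distrib]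
  exact Finset.sum_congr rfl fun j _ => partialDeriv_mul k (hM i j) (hR j i)

theorem partialDeriv_log_det {M : EuclideanSpace ℝ (Fin p) → Matrix (Fin n) (Fin n) ℝ}
    (hM : ∀ i j, DifferentiableAt ℝ (fun y => M y i j) η) (hdet : (M η).det ≠ 0) (k : Fin p) :
    partialDeriv k (fun y => Real.log (M y).det) η = ((M η)⁻¹ * matPartialDeriv k M η).trace := by
  unfold partialDeriv
  rw [(hasFDerivAt_log_det (fun i j => (hM i j).hasFDerivAt) hdet).fderiv]
  simp only [_root_.sum_apply, Matrix.trace, Matrix.diag, Matrix.mul_apply]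
  rw [Finset.sum_comm]
  simp [matPartialDeriv, partialDeriv]

theorem partialDeriv_limitCost {M : EuclideanSpace ℝ (Fin p) → Matrix (Fin n) (Fin n) ℝ}
    (hM : ∀ i j, ContDiffAt ℝ 1 (fun y => M y i j) η) (hdet : (M η).det ≠ 0) (θ : Fin n → ℝ)
    (k : Fin p) :
    partialDeriv k (fun y => limitCost θ (M y)) η
      = θ ⬝ᵥ (matPartialDeriv k (fun y => (M y)⁻¹) η *ᵥ θ)
        + ((M η)⁻¹ * matPartialDeriv k M η).trace := by
  have hd : ∀ i j, DifferentiableAt ℝ (fun y => (M y)⁻¹ i j) η := fun i j =>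
    (contDiffAt_inv_apply hM hdet i j).differentiableAt (by norm_num)
  have hd' : ∀ i j, DifferentiableAt ℝ (fun y => M y i j) η := fun i j =>
    (hM i j).differentiableAt (by norm_num)
  rw [← partialDeriv_quadForm hd, ← partialDeriv_log_det hd' hdet]
  refine partialDeriv_add k ?_ ((contDiffAt_det hM).differentiableAt (by norm_num) |>.log hdet)
  simp only [dotProduct, mulVec]
  exact DifferentiableAt.fun_sum fun i _ => (DifferentiableAt.fun_sum fun j _ =>
      (hd i j).mul_const (θ j)).const_mul (θ i)

/-- The matrix `A_b` is the Hessian of the limit cost. The entries of the two sides differ by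
the order of differentiation, so symmetry of second derivatives enters. -/
theorem matA_eq_hessian {P : EuclideanSpace ℝ (Fin p) → Matrix (Fin n) (Fin n) ℝ}
    (hP : ∀ᶠ y in 𝓝 η, ∀ i j, ContDiffAt ℝ 2 (fun y => P y i j) y)
    (hdet : ∀ᶠ y in 𝓝 η, (P y).det ≠ 0) (θ : Fin n → ℝ) (k l : Fin p) :
    matA θ P η k l = partialDeriv k (partialDeriv l fun y => limitCost θ (P y)) η := by
  have hP0 := hP.self_of_nhds
  have hdet0 := hdet.self_of_nhds
  have hI : ∀ i j, ContDiffAt ℝ 2 (fun y => (P y)⁻¹ i j) η := contDiffAt_inv_apply hP0 hdet0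
  have h12 : (1 : WithTop ℕ∞) ≤ 2 := by norm_num
  rw [partialDeriv_comm (contDiffAt_limitCost (θ := fun _ => θ) (fun _ => contDiffAt_const) hP0
    hdet0)]
  rw [partialDeriv_congr l (g := fun y => θ ⬝ᵥ (matPartialDeriv k (fun y => (P y)⁻¹) y *ᵥ θ)
        + ((P y)⁻¹ * matPartialDeriv k P y).trace)]
  · have hdI : ∀ i j, DifferentiableAt ℝ
        (fun y => matPartialDeriv k (fun y => (P y)⁻¹) y i j) η := fun i j =>
      (contDiffAt_partialDeriv k (hI i j)).differentiableAt (by norm_num)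
    have hdP : ∀ i j, DifferentiableAt ℝ (fun y => matPartialDeriv k P y i j) η := fun i j =>
      (contDiffAt_partialDeriv k (hP0 i j)).differentiableAt (by norm_num)
    have hI' : ∀ i j, DifferentiableAt ℝ (fun y => (P y)⁻¹ i j) η := fun i j =>
      (hI i j).differentiableAt (by norm_num)
    rw [partialDeriv_add, partialDeriv_quadForm hdI, partialDeriv_trace_mul hI' hdP, ← add_assoc]
    · have c1 : matPartialDeriv k (matPartialDeriv l fun y => (P y)⁻¹) η
          = matPartialDeriv l (matPartialDeriv k fun y => (P y)⁻¹) η := by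
        ext i j; exact partialDeriv_comm (hI i j) k l
      have c2 : matPartialDeriv k (matPartialDeriv l P) η
          = matPartialDeriv l (matPartialDeriv k P) η := by
        ext i j; exact partialDeriv_comm (hP0 i j) k l
      simp only [matA, Matrix.of_apply, c1, c2]
    · simp only [dotProduct, mulVec]
      exact DifferentiableAt.fun_sum fun i _ => (DifferentiableAt.fun_sum fun j _ =>
        (hdI i j).mul_const (θ j)).const_mul (θ i)
    · simp only [Matrix.trace, Matrix.diag, Matrix.mul_apply]
      exact DifferentiableAt.fun_sum fun i _ => DifferentiableAt.fun_sum fun j _ =>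
        (hI' i j).mul (hdP j i)
  · filter_upwards [hP, hdet] with y hy hy'
    exact partialDeriv_limitCost (fun i j => (hy i j).of_le h12) hy' θ k

end PartialDerivatives

/-! ### Perturbation of minimizers and of roots -/

section ArgminPerturbation

/-- Consistency of minimizers: if `w (x i, ·)` is minimized over `Ω` at `η i`, where `x i → x₀` and
`η i` stays in a compact subset of `Ω`, then every limit point of `η i` minimizes `w (x₀, ·)`;
hence `η i` converges to the minimizer `η₀` that is nearest to it. -/
theorem tendsto_argmin {ι X E : Type*} [TopologicalSpace X] [MetricSpace E] {F : Filter ι}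
    {w : X × E → ℝ} {Ω K : Set E} {x₀ : X} {η₀ : E} {x : ι → X} {η : ι → E}
    (hw : ∀ e ∈ Ω, ContinuousAt w (x₀, e)) (hx : Tendsto x F (𝓝 x₀))
    (hKΩ : K ⊆ Ω) (hK : IsCompact K) (hηK : ∀ᶠ i in F, η i ∈ K)
    (hmin : ∀ᶠ i in F, η i ∈ argminSet (fun e => w (x i, e)) Ω)
    (hnear : ∀ᶠ i in F, ∀ e ∈ argminSet (fun e => w (x₀, e)) Ω, dist (η i) η₀ ≤ dist (η i) e) :
    Tendsto η F (𝓝 η₀) := by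
  -- by compactness `η` converges along every ultrafilter; it remains to identify the limit
  rw [tendsto_iff_ultrafilter]
  intro U hU
  have hU' : ↑(U.map η) ≤ 𝓟 K :=
    le_principal_iff.2 (mem_map.2 (hηK.filter_mono hU))
  obtain ⟨e, heK, he⟩ := isCompact_iff_ultrafilter_le_nhds.1 hK (U.map η) hU'
  have he' : Tendsto η U (𝓝 e) := he
  have hmem : e ∈ argminSet (fun e => w (x₀, e)) Ω := by
    refine ⟨hKΩ heK, fun e' he'Ω => ?_⟩
    have hx' := hx.mono_left hU
    refine le_of_tendsto_of_tendsto
      ((hw e (hKΩ heK)).tendsto.comp (hx'.prodMk_nhds he'))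
      ((hw e' he'Ω).tendsto.comp (hx'.prodMk_nhds tendsto_const_nhds)) ?_
    filter_upwards [hmin.filter_mono hU] with i hi using hi.2 e' he'Ω
  have h0 : Tendsto (fun i => dist (η i) e) U (𝓝 0) := tendsto_iff_dist_tendsto_zero.1 he'
  have h1 : Tendsto (fun i => dist (η i) η₀) U (𝓝 0) :=
    squeeze_zero' (Eventually.of_forall fun i => dist_nonneg)
      ((hnear.filter_mono hU).mono fun i hi => hi e hmem) h0
  exact tendsto_iff_dist_tendsto_zero.2 h1

/-- Linearization of an implicitly defined root: if `g (x i, η i) = 0` near a root `(x₀, η₀)` at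
which `g` is differentiable with invertible partial derivative `A` in `η` and partial derivative
`C` in `x`, then `η i - η₀ = -A⁻¹ C (x i - x₀) + o(x i - x₀)`. -/
theorem isLittleO_root_expansion {ι X E E' : Type*} [NormedAddCommGroup X] [NormedSpace ℝ X]
    [NormedAddCommGroup E] [NormedSpace ℝ E] [NormedAddCommGroup E'] [NormedSpace ℝ E']
    {F : Filter ι} {g : X × E → E'} {x₀ : X} {η₀ : E} {L : X × E →L[ℝ] E'} (C : X →L[ℝ] E')
    (A : E ≃L[ℝ] E') (hL : ∀ ξ ζ, L (ξ, ζ) = C ξ + A ζ) (hg : HasFDerivAt g L (x₀, η₀))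
    (hg0 : g (x₀, η₀) = 0) {x : ι → X} {η : ι → E} (hx : Tendsto x F (𝓝 x₀))
    (hη : Tendsto η F (𝓝 η₀)) (hroot : ∀ᶠ i in F, g (x i, η i) = 0) :
    (fun i => η i - η₀ + A.symm (C (x i - x₀))) =o[F] fun i => x i - x₀ := by
  have h1 : (fun i => g (x i, η i) - g (x₀, η₀) - L ((x i, η i) - (x₀, η₀))) =o[F]
      fun i => (x i, η i) - (x₀, η₀) := hg.isLittleO.comp_tendsto (hx.prodMk_nhds hη)
  have h2 : (fun i => η i - η₀ + A.symm (C (x i - x₀))) =o[F]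
      fun i => (x i, η i) - (x₀, η₀) := by
    rw [← Asymptotics.isLittleO_neg_left]
    refine (Asymptotics.IsBigO.trans_isLittleO
      (A.symm.toContinuousLinearMap.isBigO_comp _ F) h1).congr' ?_ EventuallyEq.rfl
    filter_upwards [hroot] with i hi
    simp [hi, hg0, hL, map_add, add_comm]
  -- the increment of `η` is controlled by that of `x`, so the error is also small relative to `x`
  have h3 : (fun i => η i - η₀) =O[F] fun i => x i - x₀ := by
    obtain ⟨c, hc⟩ := ((A.symm.toContinuousLinearMap.comp C).isBigO_comp (fun i => x i - x₀) F).bound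
    refine Asymptotics.IsBigO.of_bound (2 * c + 1) ?_
    filter_upwards [hc, h2.bound (show (0 : ℝ) < 1 / 2 by norm_num)] with i hci hi
    have hp : ‖(x i, η i) - (x₀, η₀)‖ ≤ ‖x i - x₀‖ + ‖η i - η₀‖ := by
      rw [Prod.mk_sub_mk, Prod.norm_mk]
      exact max_le_add_of_nonneg (norm_nonneg _) (norm_nonneg _)
    have ht : ‖η i - η₀‖ ≤ ‖η i - η₀ + A.symm (C (x i - x₀))‖ + ‖A.symm (C (x i - x₀))‖ := by
      simpa using norm_sub_le (η i - η₀ + A.symm (C (x i - x₀))) (A.symm (C (x i - x₀)))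
    have hci' : ‖A.symm (C (x i - x₀))‖ ≤ c * ‖x i - x₀‖ := hci
    linarith
  refine h2.trans_isBigO ?_
  exact (Asymptotics.isBigO_refl _ _).prod_left h3

end ArgminPerturbation

/-! ### The empirical Bayes cost as a perturbed limit cost -/

section Ridge

variable {n N : ℕ}

theorem transpose_inv_gram (Φ : Matrix (Fin N) (Fin n) ℝ) :
    ((Φᵀ * Φ)⁻¹)ᵀ = (Φᵀ * Φ)⁻¹ := by
  rw [Matrix.transpose_nonsing_inv, Matrix.transpose_mul, Matrix.transpose_transpose]

/-- With `G = ΦᵀΦ` and `R = P + σ² G⁻¹`, the output precision matrix is the sum of a part not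
depending on `P`, supported on the orthogonal complement of the range of `Φ`, and of
`(ΦG⁻¹) R⁻¹ (ΦG⁻¹)ᵀ`. -/
theorem inv_outputCov {σ : ℝ} (hσ : σ ≠ 0) (Φ : Matrix (Fin N) (Fin n) ℝ)
    (P : Matrix (Fin n) (Fin n) ℝ) (hG : IsUnit (Φᵀ * Φ).det)
    (hR : IsUnit (P + σ ^ 2 • (Φᵀ * Φ)⁻¹).det) :
    (outputCov σ Φ P)⁻¹ = (σ ^ 2)⁻¹ • (1 - Φ * (Φᵀ * Φ)⁻¹ * Φᵀ)
      + Φ * (Φᵀ * Φ)⁻¹ * (P + σ ^ 2 • (Φᵀ * Φ)⁻¹)⁻¹ * ((Φᵀ * Φ)⁻¹ * Φᵀ) := by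
  set G := Φᵀ * Φ with hGdef
  set R := P + σ ^ 2 • G⁻¹ with hRdef
  have hG1 : G * G⁻¹ = 1 := Matrix.mul_nonsing_inv _ hG
  have hR1 : R * R⁻¹ = 1 := Matrix.mul_nonsing_inv _ hR
  have hσ2 : σ ^ 2 ≠ 0 := pow_ne_zero 2 hσ
  refine Matrix.inv_eq_right_inv ?_
  have hPi : Φᵀ * (1 - Φ * G⁻¹ * Φᵀ) = 0 := by
    rw [Matrix.mul_sub, Matrix.mul_one, ← Matrix.mul_assoc, ← Matrix.mul_assoc, ← hGdef, hG1,
      Matrix.one_mul, sub_self]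
  have h1 : outputCov σ Φ P * (1 - Φ * G⁻¹ * Φᵀ) = σ ^ 2 • (1 - Φ * G⁻¹ * Φᵀ) := by
    rw [outputCov, Matrix.add_mul, Matrix.mul_assoc, hPi, Matrix.mul_zero, zero_add,
      Matrix.smul_mul, Matrix.one_mul]
  have h2 : outputCov σ Φ P * (Φ * G⁻¹) = Φ * R := by
    rw [outputCov, Matrix.add_mul, Matrix.smul_mul, Matrix.one_mul, hRdef, Matrix.mul_add,
      Matrix.mul_smul, Matrix.mul_assoc (Φ * P), ← Matrix.mul_assoc Φᵀ, ← hGdef, hG1,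
      Matrix.mul_one]
  rw [Matrix.mul_add, Matrix.mul_smul, h1, smul_smul, inv_mul_cancel₀ hσ2, one_smul,
    Matrix.mul_assoc (Φ * G⁻¹), ← Matrix.mul_assoc (outputCov σ Φ P), h2, Matrix.mul_assoc Φ R,
    ← Matrix.mul_assoc R, hR1, Matrix.one_mul, ← Matrix.mul_assoc, sub_add_cancel]

/-- The determinant of `Q` by the identity `det (1 + AB) = det (1 + BA)`. -/
theorem det_outputCov {σ : ℝ} (hσ : σ ≠ 0) (Φ : Matrix (Fin N) (Fin n) ℝ)
    (P : Matrix (Fin n) (Fin n) ℝ) (hG : IsUnit (Φᵀ * Φ).det) :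
    (outputCov σ Φ P).det
      = (σ ^ 2) ^ N * ((σ ^ 2)⁻¹ ^ n * (Φᵀ * Φ).det) * (P + σ ^ 2 • (Φᵀ * Φ)⁻¹).det := by
  have hσ2 : σ ^ 2 ≠ 0 := pow_ne_zero 2 hσ
  have h1 : outputCov σ Φ P = σ ^ 2 • (1 + Φ * ((σ ^ 2)⁻¹ • (P * Φᵀ))) := by
    rw [outputCov, smul_add, Matrix.mul_smul, smul_smul, mul_inv_cancel₀ hσ2, one_smul,
      Matrix.mul_assoc, add_comm]
  have h2 : 1 + ((σ ^ 2)⁻¹ • (P * Φᵀ)) * Φ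
      = (P + σ ^ 2 • (Φᵀ * Φ)⁻¹) * ((σ ^ 2)⁻¹ • (Φᵀ * Φ)) := by
    rw [Matrix.add_mul, Matrix.smul_mul, Matrix.mul_smul, Matrix.mul_smul, Matrix.smul_mul,
      Matrix.nonsing_inv_mul _ hG, smul_smul, inv_mul_cancel₀ hσ2, one_smul, Matrix.mul_assoc,
      add_comm]
  rw [h1, Matrix.det_smul, Matrix.det_one_add_mul_comm, h2, Matrix.det_mul, Matrix.det_smul]
  simp only [Fintype.card_fin]
  ring

/-- Up to a term not depending on `P`, the empirical Bayes cost is the limit cost with `θ₀`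
replaced by the least squares estimate and `P` by `P + σ² (ΦᵀΦ)⁻¹`. -/
theorem costEB_eq {σ : ℝ} (hσ : σ ≠ 0) (Φ : Matrix (Fin N) (Fin n) ℝ) (Y : Fin N → ℝ)
    (hG : IsUnit (Φᵀ * Φ).det) :
    ∃ c : ℝ, ∀ P : Matrix (Fin n) (Fin n) ℝ, (P + σ ^ 2 • (Φᵀ * Φ)⁻¹).det ≠ 0 →
      costEB σ Φ Y P
        = c + limitCost ((Φᵀ * Φ)⁻¹ *ᵥ (Φᵀ *ᵥ Y)) (P + σ ^ 2 • (Φᵀ * Φ)⁻¹) := by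
  have hσ2 : σ ^ 2 ≠ 0 := pow_ne_zero 2 hσ
  refine ⟨Y ⬝ᵥ (((σ ^ 2)⁻¹ • (1 - Φ * (Φᵀ * Φ)⁻¹ * Φᵀ)) *ᵥ Y)
    + Real.log ((σ ^ 2) ^ N * ((σ ^ 2)⁻¹ ^ n * (Φᵀ * Φ).det)), fun P hR => ?_⟩
  rw [costEB, inv_outputCov hσ Φ P hG (isUnit_iff_ne_zero.2 hR), det_outputCov hσ Φ P hG,
    Real.log_mul (by simp [hσ, hG.ne_zero]) hR, limitCost, Matrix.add_mulVec, dotProduct_add]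
  have : Y ⬝ᵥ ((Φ * (Φᵀ * Φ)⁻¹ * (P + σ ^ 2 • (Φᵀ * Φ)⁻¹)⁻¹ * ((Φᵀ * Φ)⁻¹ * Φᵀ)) *ᵥ Y)
      = ((Φᵀ * Φ)⁻¹ *ᵥ (Φᵀ *ᵥ Y)) ⬝ᵥ
        ((P + σ ^ 2 • (Φᵀ * Φ)⁻¹)⁻¹ *ᵥ ((Φᵀ * Φ)⁻¹ *ᵥ (Φᵀ *ᵥ Y))) := by
    have ht : (Φ * (Φᵀ * Φ)⁻¹)ᵀ = (Φᵀ * Φ)⁻¹ * Φᵀ := by rw [Matrix.transpose_mul, transpose_inv_gram]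
    rw [Matrix.mul_assoc, ← Matrix.mulVec_mulVec, Matrix.dotProduct_mulVec,
      ← Matrix.mulVec_transpose, ht]
    simp only [Matrix.mulVec_mulVec]
  rw [this]
  ring

/-- The least squares estimate is `θ₀` plus a linear function of the noise. -/
theorem leastSquares_outputVector (θ₀ : Fin n → ℝ) (φ : ℕ → Fin n → ℝ) (v : ℕ → ℝ) (N : ℕ)
    (hG : IsUnit ((regressionMatrix φ N)ᵀ * regressionMatrix φ N).det) :
    ((regressionMatrix φ N)ᵀ * regressionMatrix φ N)⁻¹ *ᵥ
        ((regressionMatrix φ N)ᵀ *ᵥ outputVector θ₀ φ v N)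
      = θ₀ + ((regressionMatrix φ N)ᵀ * regressionMatrix φ N)⁻¹ *ᵥ
        ((regressionMatrix φ N)ᵀ *ᵥ fun t => v t) := by
  have : outputVector θ₀ φ v N = regressionMatrix φ N *ᵥ θ₀ + fun t : Fin N => v t := rfl
  rw [this, Matrix.mulVec_add, Matrix.mulVec_add, Matrix.mulVec_mulVec, Matrix.mulVec_mulVec,
    Matrix.mul_assoc, Matrix.nonsing_inv_mul _ hG, Matrix.one_mulVec]

end Ridge

/-! ### Asymptotic normality of least squares -/

section GaussianLimit

theorem measurable_det {α : Type*} [MeasurableSpace α] {n : ℕ} {M : α → Matrix (Fin n) (Fin n) ℝ}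
    (hM : ∀ i j, Measurable fun x => M x i j) : Measurable fun x => (M x).det := by
  simp only [Matrix.det_apply]
  exact Finset.measurable_fun_sum _ fun s _ =>
    (Finset.measurable_fun_prod _ fun i _ => hM _ _).const_smul _

theorem measurable_inv_apply {α : Type*} [MeasurableSpace α] {n : ℕ}
    {M : α → Matrix (Fin n) (Fin n) ℝ} (hM : ∀ i j, Measurable fun x => M x i j) (i j : Fin n) :
    Measurable fun x => (M x)⁻¹ i j := by
  have h : (fun x => (M x)⁻¹ i j)
      = fun x => (M x).det⁻¹ * ((M x).updateRow j (Pi.single i 1)).det := by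
    funext x
    simp [Matrix.inv_def, Matrix.adjugate_apply]
  rw [h]
  refine (measurable_det hM).inv.mul (measurable_det fun a b => ?_)
  by_cases hj : a = j
  · subst hj; simp
  · simpa [Matrix.updateRow_ne hj] using hM a b

theorem tendsto_inv_apply {ι : Type*} {F : Filter ι} {n : ℕ} {M : ι → Matrix (Fin n) (Fin n) ℝ}
    {S : Matrix (Fin n) (Fin n) ℝ} (hM : Tendsto M F (𝓝 S)) (hS : S.det ≠ 0) (i j : Fin n) :
    Tendsto (fun x => (M x)⁻¹ i j) F (𝓝 (S⁻¹ i j)) := by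
  have h := ((continuousAt_matrix_inv S (by
    simpa [Ring.inverse_eq_inv'] using continuousAt_inv₀ hS)).tendsto.comp hM)
  exact (tendsto_pi_nhds.1 (tendsto_pi_nhds.1 h i) j)

/-- The scaled error `√N (ΦᵀΦ)⁻¹ Φᵀ V` of the least squares estimate; it is `0` when `ΦᵀΦ` is
singular, since the matrix inverse is then `0`. -/
def scaledLSError {n : ℕ} (φ : ℕ → Fin n → ℝ) (v : ℕ → ℝ) (N : ℕ) : Fin n → ℝ :=
  √(N : ℝ) • (((regressionMatrix φ N)ᵀ * regressionMatrix φ N)⁻¹ *ᵥ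
    ((regressionMatrix φ N)ᵀ *ᵥ fun t => v t))

/-- The coefficients of the noise in the linear form `⟨u, √N (ΦᵀΦ)⁻¹ Φᵀ V⟩`. -/
def noiseWeights {n : ℕ} (u : Fin n → ℝ) (N : ℕ) (φ : ℕ → Fin n → ℝ) : Fin N → ℝ :=
  √(N : ℝ) • (regressionMatrix φ N *ᵥ
    (((regressionMatrix φ N)ᵀ * regressionMatrix φ N)⁻¹ *ᵥ u))

variable {n p : ℕ}

/-- This also holds for `N = 0` and for singular `ΦᵀΦ`, where both sides are `0`. -/
theorem inv_smul_gram {N : ℕ} (Φ : Matrix (Fin N) (Fin n) ℝ) :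
    ((N : ℝ)⁻¹ • (Φᵀ * Φ))⁻¹ = (N : ℝ) • (Φᵀ * Φ)⁻¹ := by
  rcases Nat.eq_zero_or_pos N with rfl | hN
  · simp
  · by_cases h : IsUnit (Φᵀ * Φ).det
    · have hN' : (N : ℝ) ≠ 0 := by positivity
      refine Matrix.inv_eq_right_inv ?_
      rw [Matrix.smul_mul, Matrix.mul_smul, Matrix.mul_nonsing_inv _ h, smul_smul,
        inv_mul_cancel₀ hN', one_smul]
    · rw [Matrix.nonsing_inv_apply_not_isUnit _ h, smul_zero,
        Matrix.nonsing_inv_apply_not_isUnit]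
      rw [Matrix.det_smul]
      intro h'
      exact h (isUnit_of_mul_isUnit_right h')

theorem dotProduct_scaledLSError (u : Fin n → ℝ) (φ : ℕ → Fin n → ℝ) (v : ℕ → ℝ) (N : ℕ) :
    u ⬝ᵥ scaledLSError φ v N = noiseWeights u N φ ⬝ᵥ fun t => v t := by
  rw [scaledLSError, noiseWeights, dotProduct_smul, smul_dotProduct, Matrix.dotProduct_mulVec,
    ← Matrix.mulVec_transpose, transpose_inv_gram, Matrix.dotProduct_mulVec,
    ← Matrix.mulVec_transpose, Matrix.transpose_transpose]

/-- The conditional variance of a linear form in the scaled least squares error. As the inverse of a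
singular matrix is `0`, the identity needs no invertibility. -/
theorem noiseWeights_dotProduct_self (u : Fin n → ℝ) (φ : ℕ → Fin n → ℝ) (N : ℕ) :
    noiseWeights u N φ ⬝ᵥ noiseWeights u N φ
      = u ⬝ᵥ (((N : ℝ)⁻¹ • ((regressionMatrix φ N)ᵀ * regressionMatrix φ N))⁻¹ *ᵥ u) := by
  set Φ := regressionMatrix φ N
  have hGGG : (Φᵀ * Φ)⁻¹ * (Φᵀ * Φ) * (Φᵀ * Φ)⁻¹ = (Φᵀ * Φ)⁻¹ := by
    by_cases h : IsUnit (Φᵀ * Φ).det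
    · rw [Matrix.nonsing_inv_mul _ h, Matrix.one_mul]
    · rw [Matrix.nonsing_inv_apply_not_isUnit _ h, Matrix.mul_zero]
  rw [inv_smul_gram, noiseWeights, smul_dotProduct, dotProduct_smul, smul_smul,
    Real.mul_self_sqrt (Nat.cast_nonneg N), Matrix.smul_mulVec, dotProduct_smul]
  congr 1
  have h1 : ∀ w, (Φ *ᵥ w) ⬝ᵥ (Φ *ᵥ w) = w ⬝ᵥ ((Φᵀ * Φ) *ᵥ w) := fun w => by
    rw [Matrix.dotProduct_mulVec, ← Matrix.mulVec_transpose, Matrix.mulVec_mulVec, dotProduct_comm]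
  have h2 : ∀ x, ((Φᵀ * Φ)⁻¹ *ᵥ u) ⬝ᵥ x = u ⬝ᵥ ((Φᵀ * Φ)⁻¹ *ᵥ x) := fun x => by
    rw [Matrix.dotProduct_mulVec u, ← Matrix.mulVec_transpose, transpose_inv_gram]
  change (Φ *ᵥ ((Φᵀ * Φ)⁻¹ *ᵥ u)) ⬝ᵥ (Φ *ᵥ ((Φᵀ * Φ)⁻¹ *ᵥ u)) = _
  rw [h1, h2, Matrix.mulVec_mulVec, Matrix.mulVec_mulVec, hGGG]

theorem measurable_gram {N : ℕ} (i j : Fin n) :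
    Measurable fun φ : ℕ → Fin n → ℝ =>
      ((regressionMatrix φ N)ᵀ * regressionMatrix φ N) i j := by
  simp only [Matrix.mul_apply, Matrix.transpose_apply, regressionMatrix, Matrix.of_apply]
  fun_prop

theorem measurable_noiseWeights (u : Fin n → ℝ) (N : ℕ) : Measurable (noiseWeights u N) := by
  refine measurable_pi_lambda _ fun t => ?_
  simp only [noiseWeights, Pi.smul_apply, mulVec, dotProduct, smul_eq_mul, regressionMatrix,
    Matrix.of_apply]
  refine Measurable.const_mul (Finset.measurable_fun_sum _ fun i _ => Measurable.mul (by fun_prop)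
    (Finset.measurable_fun_sum _ fun j _ => Measurable.mul_const ?_ _)) _
  exact measurable_inv_apply measurable_gram i j

variable {𝓢 : Type*} [MeasurableSpace 𝓢] {μ : Measure 𝓢} [IsProbabilityMeasure μ]

/-- Conditionally on `β`, a linear form in independent Gaussian noise with `β`-measurable weights is
Gaussian: this is its characteristic function at `1`. -/
theorem integral_cexp_dotProduct_gaussian {α : Type*} [MeasurableSpace α] {β : 𝓢 → α}
    (hβ : Measurable β) {N : ℕ} {τ : NNReal} {V : 𝓢 → Fin N → ℝ}
    (hV : HasLaw V (Measure.pi fun _ => gaussianReal 0 τ) μ) (hind : IndepFun β V μ)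
    {a : α → Fin N → ℝ} (ha : Measurable a) :
    ∫ ω, Complex.exp (((a (β ω) ⬝ᵥ V ω : ℝ) : ℂ) * Complex.I) ∂μ
      = ∫ ω, ((Real.exp (-(τ * (a (β ω) ⬝ᵥ a (β ω)) / 2)) : ℝ) : ℂ) ∂μ := by
  have hβlaw : HasLaw β (μ.map β) μ := ⟨hβ.aemeasurable, rfl⟩
  have : IsProbabilityMeasure (μ.map β) := Measure.isProbabilityMeasure_map hβ.aemeasurable
  have hlaw := hind.hasLaw_prod hβlaw hV
  have hdot : Measurable fun x : α × (Fin N → ℝ) => a x.1 ⬝ᵥ x.2 := by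
    simp only [dotProduct]; fun_prop
  have hf : Measurable fun x : α × (Fin N → ℝ) =>
      Complex.exp (((a x.1 ⬝ᵥ x.2 : ℝ) : ℂ) * Complex.I) := by fun_prop
  have haa : Measurable fun x : α => a x ⬝ᵥ a x := by
    simp only [dotProduct]; fun_prop
  have h1 := hlaw.integral_comp (f := fun x : α × (Fin N → ℝ) =>
      Complex.exp (((a x.1 ⬝ᵥ x.2 : ℝ) : ℂ) * Complex.I)) hf.aestronglyMeasurable
  have h2 := hβlaw.integral_comp (f := fun x : α =>
      ((Real.exp (-(τ * (a x ⬝ᵥ a x) / 2)) : ℝ) : ℂ))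
      (by fun_prop : Measurable fun x : α =>
        ((Real.exp (-(τ * (a x ⬝ᵥ a x) / 2)) : ℝ) : ℂ)).aestronglyMeasurable
  refine h1.trans (Eq.trans ?_ h2.symm)
  rw [integral_prod]
  · refine integral_congr_ae (Eventually.of_forall fun x => ?_)
    have h3 : ∀ y : Fin N → ℝ, Complex.exp (((a x ⬝ᵥ y : ℝ) : ℂ) * Complex.I)
        = ∏ i, Complex.exp ((a x i : ℂ) * (y i : ℂ) * Complex.I) := by
      intro y
      rw [← Complex.exp_sum, dotProduct, Complex.ofReal_sum, Finset.sum_mul]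
      simp
    simp only [h3]
    rw [integral_fintype_prod_eq_prod
      (f := fun i (y : ℝ) => Complex.exp ((a x i : ℂ) * (y : ℂ) * Complex.I))]
    simp_rw [← charFun_apply_real, charFun_gaussianReal]
    rw [← Complex.exp_sum, Complex.ofReal_exp]
    congr 1
    simp only [dotProduct, Complex.ofReal_neg, Complex.ofReal_div, Complex.ofReal_mul,
      Complex.ofReal_sum, Complex.ofReal_zero, mul_zero, zero_mul, zero_sub, Finset.mul_sum,
      Finset.sum_div, Finset.sum_neg_distrib, Complex.ofReal_ofNat]
    congr 1
    refine Finset.sum_congr rfl fun i _ => ?_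
    ring
  · refine Integrable.of_bound hf.aestronglyMeasurable 1 (Eventually.of_forall fun x => ?_)
    rw [Complex.norm_exp_ofReal_mul_I]

/-- Asymptotic normality of linear images of the least squares estimate: the characteristic function
is the mean of the conditional one, which converges almost surely and is bounded by `1`. -/
theorem tendstoInDistribution_scaledLSError {σ : ℝ} {φ : ℕ → 𝓢 → Fin n → ℝ}
    (hφ : ∀ t, Measurable (φ t)) {v : ℕ → 𝓢 → ℝ} (hv : ∀ t, Measurable (v t))
    (hvlaw : ∀ t, HasLaw (v t) (gaussianReal 0 (Real.toNNReal (σ ^ 2))) μ)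
    (hvindep : iIndepFun v μ)
    (hφv : IndepFun (fun ω t => φ t ω) (fun ω t => v t ω) μ)
    {S : Matrix (Fin n) (Fin n) ℝ} (hS : S.PosDef)
    (hΦ : ∀ᵐ ω ∂μ, Tendsto
      (fun N : ℕ => (N : ℝ)⁻¹ •
        ((regressionMatrix (fun t => φ t ω) N)ᵀ * regressionMatrix (fun t => φ t ω) N))
      atTop (𝓝 S)) (M : Matrix (Fin p) (Fin n) ℝ) :
    TendstoInDistribution
      (fun (N : ℕ) ω => (WithLp.toLp 2 (M *ᵥ scaledLSError (fun t => φ t ω) (fun t => v t ω) N) :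
        EuclideanSpace ℝ (Fin p))) atTop
      (id : EuclideanSpace ℝ (Fin p) → EuclideanSpace ℝ (Fin p)) (fun _ => μ)
      (multivariateGaussian 0 (σ ^ 2 • (M * S⁻¹ * Mᵀ))) := by
  have hφm : Measurable fun ω t => φ t ω := measurable_pi_lambda _ hφ
  have hdot : ∀ (u : Fin n → ℝ) (N : ℕ), Measurable fun ω =>
      u ⬝ᵥ scaledLSError (fun t => φ t ω) (fun t => v t ω) N := by
    intro u N
    simp only [dotProduct_scaledLSError]
    simp only [dotProduct]
    have := (measurable_noiseWeights u N).comp hφm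
    refine Finset.measurable_fun_sum _ fun i _ => Measurable.mul ?_ (hv _)
    exact (measurable_pi_apply i).comp this
  have hX : ∀ N : ℕ, Measurable fun ω =>
      (WithLp.toLp 2 (M *ᵥ scaledLSError (fun t => φ t ω) (fun t => v t ω) N) :
        EuclideanSpace ℝ (Fin p)) := fun N =>
    (WithLp.measurable_toLp 2 _).comp (measurable_pi_lambda _ fun k => hdot (M k) N)
  have hpsd : (σ ^ 2 • (M * S⁻¹ * Mᵀ)).PosSemidef := by
    have := (hS.inv.posSemidef.mul_mul_conjTranspose_same M).smul (sq_nonneg σ)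
    rwa [Matrix.conjTranspose_eq_transpose_of_trivial] at this
  refine ⟨fun N => (hX N).aemeasurable, aemeasurable_id, ?_⟩
  refine ProbabilityMeasure.tendsto_iff_tendsto_charFun.2 fun t => ?_
  simp only [ProbabilityMeasure.coe_mk, Measure.map_id]
  rw [charFun_multivariateGaussian hpsd]
  set u : Fin n → ℝ := Mᵀ *ᵥ t.ofLp with hu
  have hchar : ∀ N : ℕ, charFun (μ.map fun ω =>
      (WithLp.toLp 2 (M *ᵥ scaledLSError (fun t => φ t ω) (fun t => v t ω) N) :
        EuclideanSpace ℝ (Fin p))) t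
      = ∫ ω, ((Real.exp (-(σ ^ 2 * (noiseWeights u N (fun t => φ t ω) ⬝ᵥ
        noiseWeights u N (fun t => φ t ω)) / 2)) : ℝ) : ℂ) ∂μ := by
    intro N
    rw [charFun_apply, integral_map (hX N).aemeasurable
      (by fun_prop : Measurable fun x : EuclideanSpace ℝ (Fin p) =>
        Complex.exp ((inner ℝ x t : ℂ) * Complex.I)).aestronglyMeasurable]
    have hinner : ∀ ω, inner ℝ (WithLp.toLp 2 (M *ᵥ scaledLSError (fun t => φ t ω)
        (fun t => v t ω) N) : EuclideanSpace ℝ (Fin p)) t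
        = noiseWeights u N (fun t => φ t ω) ⬝ᵥ (fun s : Fin N => v s ω) := by
      intro ω
      rw [← dotProduct_scaledLSError u (fun t => φ t ω) (fun t => v t ω) N, hu,
        Matrix.mulVec_transpose, ← Matrix.dotProduct_mulVec]
      simp [PiLp.inner_apply, dotProduct]
    simp only [hinner]
    have hVlaw : HasLaw (fun ω (s : Fin N) => v s ω)
        (Measure.pi fun _ => gaussianReal 0 (Real.toNNReal (σ ^ 2))) μ :=
      (hvindep.precomp Fin.val_injective).hasLaw_pi fun s => hvlaw s
    have hind : IndepFun (fun ω t => φ t ω) (fun ω (s : Fin N) => v s ω) μ :=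
      hφv.comp (ψ := fun (w : ℕ → ℝ) (s : Fin N) => w s) measurable_id (by fun_prop)
    rw [integral_cexp_dotProduct_gaussian hφm hVlaw hind (measurable_noiseWeights u N)]
    rw [Real.coe_toNNReal _ (sq_nonneg σ)]
  simp only [hchar]
  have hlim : Complex.exp ((inner ℝ t (0 : EuclideanSpace ℝ (Fin p)) : ℂ) * Complex.I
      - ((t.ofLp ⬝ᵥ (σ ^ 2 • (M * S⁻¹ * Mᵀ)) *ᵥ t.ofLp : ℝ) : ℂ) / 2)
      = ∫ _, ((Real.exp (-(σ ^ 2 * (u ⬝ᵥ (S⁻¹ *ᵥ u)) / 2)) : ℝ) : ℂ) ∂μ := by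
    have : t.ofLp ⬝ᵥ (σ ^ 2 • (M * S⁻¹ * Mᵀ)) *ᵥ t.ofLp = σ ^ 2 * (u ⬝ᵥ (S⁻¹ *ᵥ u)) := by
      rw [Matrix.smul_mulVec, dotProduct_smul, ← Matrix.mulVec_mulVec, ← Matrix.mulVec_mulVec,
        Matrix.dotProduct_mulVec, ← Matrix.mulVec_transpose, smul_eq_mul]
    rw [this]
    simp
  rw [hlim]
  refine tendsto_integral_of_dominated_convergence (fun _ => 1) (fun N => ?_)
    (integrable_const 1) (fun N => Eventually.of_forall fun ω => ?_) ?_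
  · have h1 := (measurable_noiseWeights u N).comp hφm
    have h2 : Measurable fun ω => noiseWeights u N (fun t => φ t ω) ⬝ᵥ
        noiseWeights u N (fun t => φ t ω) := by
      simp only [dotProduct]
      exact Finset.measurable_fun_sum _ fun i _ =>
        ((measurable_pi_apply i).comp h1).mul ((measurable_pi_apply i).comp h1)
    exact (by fun_prop : Measurable _).aestronglyMeasurable
  · rw [Complex.norm_real, Real.norm_eq_abs, abs_of_pos (Real.exp_pos _), Real.exp_le_one_iff,
      neg_nonpos]
    have : 0 ≤ noiseWeights u N (fun t => φ t ω) ⬝ᵥ noiseWeights u N (fun t => φ t ω) :=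
      Finset.sum_nonneg fun i _ => mul_self_nonneg _
    positivity
  · filter_upwards [hΦ] with ω hω
    have hconv : Tendsto (fun N => noiseWeights u N (fun t => φ t ω) ⬝ᵥ
        noiseWeights u N (fun t => φ t ω)) atTop (𝓝 (u ⬝ᵥ (S⁻¹ *ᵥ u))) := by
      simp only [noiseWeights_dotProduct_self]
      simp only [dotProduct, mulVec]
      exact tendsto_finsetSum _ fun i _ => (tendsto_finsetSum _ fun j _ =>
        (tendsto_inv_apply hω hS.det_pos.ne' i j).mul_const _).const_mul _
    exact (Complex.continuous_ofReal.tendsto _).comp ((Real.continuous_exp.tendsto _).comp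
      ((hconv.const_mul (σ ^ 2)).div_const 2).neg)

/-- A sequence that converges in distribution is bounded in probability. -/
theorem isTightMeasureSet_of_tendstoInDistribution {E Ω' : Type*} [NormedAddCommGroup E]
    [InnerProductSpace ℝ E] [FiniteDimensional ℝ E] [MeasurableSpace E] [BorelSpace E]
    [MeasurableSpace Ω'] {ν : Measure Ω'} [IsProbabilityMeasure ν] {X : ℕ → 𝓢 → E} {Z : Ω' → E}
    (h : TendstoInDistribution X atTop Z (fun _ => μ) ν) :
    IsTightMeasureSet (Set.range fun N => μ.map (X N)) := by
  have hp : ∀ N, IsProbabilityMeasure (μ.map (X N)) := fun N =>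
    Measure.isProbabilityMeasure_map (h.forall_aemeasurable N)
  have hp' : IsProbabilityMeasure (ν.map Z) :=
    Measure.isProbabilityMeasure_map h.aemeasurable_limit
  exact isTightMeasureSet_of_tendsto_charFun (f := charFun (ν.map Z)) (by fun_prop)
    (ProbabilityMeasure.tendsto_iff_tendsto_charFun.1 h.tendsto)

end GaussianLimit

/-! ### The score and its linearization -/

section PerturbedCost

variable {n p : ℕ}

/-- The limit cost with `θ₀` replaced by `θ` and the kernel matrix `P η` by `P η + E`, as a function
of `((θ, E), η)`. Matrices `E` are plain functions here, so that they carry the sup norm. -/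
def perturbedCost (P : EuclideanSpace ℝ (Fin p) → Matrix (Fin n) (Fin n) ℝ)
    (y : ((Fin n → ℝ) × (Fin n → Fin n → ℝ)) × EuclideanSpace ℝ (Fin p)) : ℝ :=
  limitCost y.1.1 (P y.2 + Matrix.of y.1.2)

/-- The gradient of `perturbedCost P` with respect to `η`. -/
def score (P : EuclideanSpace ℝ (Fin p) → Matrix (Fin n) (Fin n) ℝ)
    (y : ((Fin n → ℝ) × (Fin n → Fin n → ℝ)) × EuclideanSpace ℝ (Fin p)) : Fin p → ℝ :=
  fun k => fderiv ℝ (perturbedCost P) y (0, EuclideanSpace.single k 1)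

/-- The mixed derivative of the limit cost in `η` and `θ`: its rows are
`2 (∂P⁻¹/∂η_k) θ₀`. -/
def sensitivity (θ₀ : Fin n → ℝ) (P : EuclideanSpace ℝ (Fin p) → Matrix (Fin n) (Fin n) ℝ)
    (η : EuclideanSpace ℝ (Fin p)) : Matrix (Fin p) (Fin n) ℝ :=
  Matrix.of fun k => (2 : ℝ) • (matPartialDeriv k (fun η' => (P η')⁻¹) η *ᵥ θ₀)

/-- An invertible matrix as a continuous linear equivalence from Euclidean space. -/
def mulVecEquiv (A : Matrix (Fin p) (Fin p) ℝ) (hA : IsUnit A.det) :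
    EuclideanSpace ℝ (Fin p) ≃L[ℝ] (Fin p → ℝ) :=
  LinearEquiv.toContinuousLinearEquiv
    { toFun := fun ζ => A *ᵥ ζ.ofLp
      invFun := fun r => WithLp.toLp 2 (A⁻¹ *ᵥ r)
      map_add' := fun x y => by simp [Matrix.mulVec_add]
      map_smul' := fun c x => by simp [Matrix.mulVec_smul]
      left_inv := fun x => by simp [Matrix.mulVec_mulVec, Matrix.nonsing_inv_mul _ hA]
      right_inv := fun x => by simp [Matrix.mulVec_mulVec, Matrix.mul_nonsing_inv _ hA] }

theorem mulVecEquiv_apply (A : Matrix (Fin p) (Fin p) ℝ) (hA : IsUnit A.det)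
    (ζ : EuclideanSpace ℝ (Fin p)) : mulVecEquiv A hA ζ = A *ᵥ ζ.ofLp := rfl

theorem mulVecEquiv_symm_apply (A : Matrix (Fin p) (Fin p) ℝ) (hA : IsUnit A.det)
    (r : Fin p → ℝ) : (mulVecEquiv A hA).symm r = WithLp.toLp 2 (A⁻¹ *ᵥ r) := rfl

variable {P : EuclideanSpace ℝ (Fin p) → Matrix (Fin n) (Fin n) ℝ} {η : EuclideanSpace ℝ (Fin p)}

theorem contDiffAt_perturbedCost (hP : ∀ i j, ContDiffAt ℝ 2 (fun y => P y i j) η)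
    (hdet : (P η).det ≠ 0) (θ : Fin n → ℝ) :
    ContDiffAt ℝ 2 (perturbedCost P) ((θ, 0), η) := by
  refine contDiffAt_limitCost (fun i => ?_) (fun i j => ?_) ?_
  · exact (contDiffAt_pi.1 (contDiffAt_fst.fst) i)
  · refine ContDiffAt.add ?_ ?_
    · exact ContDiffAt.comp (g := fun y => P y i j)
        (((θ, 0), η) : ((Fin n → ℝ) × (Fin n → Fin n → ℝ)) × EuclideanSpace ℝ (Fin p))
        (hP i j) contDiffAt_snd
    · exact contDiffAt_pi.1 (contDiffAt_pi.1 contDiffAt_fst.snd i) j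
  · have : P η + Matrix.of (0 : Fin n → Fin n → ℝ) = P η := by ext; simp
    simpa [this] using hdet

theorem perturbedCost_zero (θ : Fin n → ℝ) (η : EuclideanSpace ℝ (Fin p)) :
    perturbedCost P ((θ, 0), η) = limitCost θ (P η) := by
  simp [perturbedCost]

theorem score_eq_partialDeriv
    {x : (Fin n → ℝ) × (Fin n → Fin n → ℝ)} (h : DifferentiableAt ℝ (perturbedCost P) (x, η))
    (k : Fin p) : score P (x, η) k = partialDeriv k (fun y => perturbedCost P (x, y)) η := by
  have h1 : HasFDerivAt (fun y => perturbedCost P (x, y))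
      ((fderiv ℝ (perturbedCost P) (x, η)).comp (ContinuousLinearMap.inr ℝ _ _)) η :=
    h.hasFDerivAt.comp η (hasFDerivAt_prodMk_right x η)
  rw [partialDeriv, h1.fderiv]
  rfl

theorem score_eq_zero_of_isLocalMin
    {x : (Fin n → ℝ) × (Fin n → Fin n → ℝ)} (h : DifferentiableAt ℝ (perturbedCost P) (x, η))
    (hmin : IsLocalMin (fun y => perturbedCost P (x, y)) η) : score P (x, η) = 0 := by
  ext k
  rw [score_eq_partialDeriv h, partialDeriv, hmin.fderiv_eq_zero]
  rfl

theorem matA_symm (hP : ∀ᶠ y in 𝓝 η, ∀ i j, ContDiffAt ℝ 2 (fun y => P y i j) y)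
    (hdet : ∀ᶠ y in 𝓝 η, (P y).det ≠ 0) (θ : Fin n → ℝ) : (matA θ P η)ᵀ = matA θ P η := by
  ext k l
  rw [Matrix.transpose_apply, matA_eq_hessian hP hdet, matA_eq_hessian hP hdet]
  exact partialDeriv_comm (contDiffAt_limitCost (θ := fun _ => θ) (fun _ => contDiffAt_const)
    hP.self_of_nhds hdet.self_of_nhds) l k

theorem matPartialDeriv_inv_symm (hPs : ∀ᶠ y in 𝓝 η, (P y)ᵀ = P y) (k : Fin p) :
    (matPartialDeriv k (fun y => (P y)⁻¹) η)ᵀ = matPartialDeriv k (fun y => (P y)⁻¹) η := by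
  ext i j
  refine partialDeriv_congr k ?_
  filter_upwards [hPs] with y hy
  conv_rhs => rw [← hy, ← Matrix.transpose_nonsing_inv]
  rfl

/-- The derivative of the score at the unperturbed problem: the Hessian `A_b` in the direction of
`η`, the sensitivity matrix in the direction of `θ`. -/
theorem exists_hasFDerivAt_score (hP : ∀ᶠ y in 𝓝 η, ∀ i j, ContDiffAt ℝ 2 (fun y => P y i j) y)
    (hdet : ∀ᶠ y in 𝓝 η, (P y).det ≠ 0) (hPs : ∀ᶠ y in 𝓝 η, (P y)ᵀ = P y) (θ₀ : Fin n → ℝ) :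
    ∃ L : ((Fin n → ℝ) × (Fin n → Fin n → ℝ)) × EuclideanSpace ℝ (Fin p) →L[ℝ] (Fin p → ℝ),
      HasFDerivAt (score P) L ((θ₀, 0), η) ∧
      (∀ ζ : EuclideanSpace ℝ (Fin p), L (0, ζ) = matA θ₀ P η *ᵥ ζ.ofLp) ∧
      (∀ h : Fin n → ℝ, L ((h, 0), 0) = sensitivity θ₀ P η *ᵥ h) := by
  have hcd : ∀ θ : Fin n → ℝ, ContDiffAt ℝ 2 (perturbedCost P) ((θ, 0), η) := fun θ =>
    contDiffAt_perturbedCost hP.self_of_nhds hdet.self_of_nhds θ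
  have hdiff : DifferentiableAt ℝ (score P) ((θ₀, 0), η) := by
    refine differentiableAt_pi.2 fun k => ?_
    exact (((hcd θ₀).fderiv_right (m := 1) (by norm_num)).clm_apply
      contDiffAt_const).differentiableAt (by norm_num)
  refine ⟨fderiv ℝ (score P) ((θ₀, 0), η), hdiff.hasFDerivAt, fun ζ => ?_, fun h => ?_⟩
  · set L := fderiv ℝ (score P) ((θ₀, 0), η) with hL
    have hbasis : ∀ k l, L (0, EuclideanSpace.single l 1) k = matA θ₀ P η k l := by
      intro k l
      have h1 : HasFDerivAt (fun y => score P ((θ₀, 0), y))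
          (L.comp (ContinuousLinearMap.inr ℝ _ _)) η :=
        hdiff.hasFDerivAt.comp η (hasFDerivAt_prodMk_right (θ₀, 0) η)
      have h2 : HasFDerivAt (fun y => score P ((θ₀, 0), y) k) _ η := hasFDerivAt_pi'.1 h1 k
      have h3 : (fun y => score P ((θ₀, 0), y) k)
          =ᶠ[𝓝 η] partialDeriv k fun y => limitCost θ₀ (P y) := by
        filter_upwards [hP, hdet] with y hy hy'
        rw [score_eq_partialDeriv
          ((contDiffAt_perturbedCost hy hy' θ₀).differentiableAt (by norm_num))]
        simp only [perturbedCost_zero]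
      rw [← matA_symm hP hdet, Matrix.transpose_apply, matA_eq_hessian hP hdet,
        ← partialDeriv_congr l h3, partialDeriv, h2.fderiv]
      rfl
    have hζ : ((0, ζ) : ((Fin n → ℝ) × (Fin n → Fin n → ℝ)) × EuclideanSpace ℝ (Fin p))
        = ∑ l, ζ l • (0, EuclideanSpace.single l 1) := by
      refine Prod.ext (by simp [Prod.fst_sum]) ?_
      ext i
      simp [Prod.snd_sum, Finset.sum_apply, Pi.single_apply]
    ext k
    rw [hζ, map_sum, Finset.sum_apply]
    simp only [map_smul, Pi.smul_apply, hbasis, smul_eq_mul, mulVec, dotProduct]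
    exact Finset.sum_congr rfl fun l _ => mul_comm _ _
  · ext k
    -- along the line `θ₀ + s h` the `k`-th component of the score is a quadratic polynomial in `s`
    set Q := matPartialDeriv k (fun y => (P y)⁻¹) η with hQ
    have hQs : Qᵀ = Q := matPartialDeriv_inv_symm hPs k
    have hline : HasDerivAt (fun s : ℝ =>
        (((θ₀ + s • h, 0), η) : ((Fin n → ℝ) × (Fin n → Fin n → ℝ)) × EuclideanSpace ℝ (Fin p)))
        ((h, 0), 0) 0 := by
      have h0 : HasDerivAt (fun s : ℝ => θ₀ + s • h) h 0 := by
        simpa using ((hasDerivAt_id (0 : ℝ)).smul_const h).const_add θ₀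
      exact (h0.prodMk (hasDerivAt_const _ _)).prodMk (hasDerivAt_const _ _)
    have h1 : HasDerivAt (fun s : ℝ => score P ((θ₀ + s • h, 0), η) k)
        (fderiv ℝ (score P) ((θ₀, 0), η) ((h, 0), 0) k) 0 := by
      have : HasFDerivAt (score P) (fderiv ℝ (score P) ((θ₀, 0), η))
          ((θ₀ + (0 : ℝ) • h, 0), η) := by simpa using hdiff.hasFDerivAt
      exact hasDerivAt_pi.1 (this.comp_hasDerivAt (0 : ℝ) hline) k
    have h2 : (fun s : ℝ => score P ((θ₀ + s • h, 0), η) k) = fun s : ℝ =>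
        (θ₀ ⬝ᵥ (Q *ᵥ θ₀) + ((P η)⁻¹ * matPartialDeriv k P η).trace)
          + s * (2 * ((Q *ᵥ θ₀) ⬝ᵥ h)) + s ^ 2 * (h ⬝ᵥ (Q *ᵥ h)) := by
      funext s
      rw [score_eq_partialDeriv ((hcd _).differentiableAt (by norm_num))]
      simp only [perturbedCost_zero]
      rw [partialDeriv_limitCost
        (fun i j => (hP.self_of_nhds i j).of_le (by norm_num)) hdet.self_of_nhds]
      have hsw : θ₀ ⬝ᵥ (Q *ᵥ h) = (Q *ᵥ θ₀) ⬝ᵥ h := by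
        rw [Matrix.dotProduct_mulVec, ← Matrix.mulVec_transpose, hQs]
      have hsw' : h ⬝ᵥ (Q *ᵥ θ₀) = (Q *ᵥ θ₀) ⬝ᵥ h := dotProduct_comm _ _
      rw [← hQ, Matrix.mulVec_add, Matrix.mulVec_smul, add_dotProduct, dotProduct_add,
        dotProduct_add, dotProduct_smul, dotProduct_smul, smul_dotProduct, smul_dotProduct, hsw,
        hsw']
      simp only [smul_eq_mul]
      ring
    have h3 : ∀ a b c : ℝ, HasDerivAt (fun s : ℝ => a + s * b + s ^ 2 * c) b 0 := fun a b c => by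
      have := (((hasDerivAt_id' (0 : ℝ)).mul_const b).const_add a).fun_add
        (((hasDerivAt_id' (0 : ℝ)).fun_pow 2).mul_const c)
      simpa using this
    rw [h2] at h1
    rw [h1.unique (h3 _ _ _)]
    change _ = ((2 : ℝ) • (Q *ᵥ θ₀)) ⬝ᵥ h
    rw [smul_dotProduct, smul_eq_mul]

/-- The covariance of the linearized estimate is `A_b⁻¹ B_b A_b⁻¹`. -/
theorem sensitivity_covariance {θ₀ : Fin n → ℝ} (hAs : (matA θ₀ P η)ᵀ = matA θ₀ P η)
    (hPs : ∀ᶠ y in 𝓝 η, (P y)ᵀ = P y) (σ : ℝ) (S : Matrix (Fin n) (Fin n) ℝ) :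
    σ ^ 2 • (-((matA θ₀ P η)⁻¹ * sensitivity θ₀ P η) * S⁻¹
        * (-((matA θ₀ P η)⁻¹ * sensitivity θ₀ P η))ᵀ)
      = (matA θ₀ P η)⁻¹ * matB σ S θ₀ P η * (matA θ₀ P η)⁻¹ := by
  have hB : matB σ S θ₀ P η
      = σ ^ 2 • (sensitivity θ₀ P η * S⁻¹ * (sensitivity θ₀ P η)ᵀ) := by
    ext k l
    set Q := fun k => matPartialDeriv k (fun y => (P y)⁻¹) η with hQ
    have hs : (sensitivity θ₀ P η * S⁻¹ * (sensitivity θ₀ P η)ᵀ) k l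
        = ((2 : ℝ) • (Q k *ᵥ θ₀)) ⬝ᵥ (S⁻¹ *ᵥ ((2 : ℝ) • (Q l *ᵥ θ₀))) := by
      rw [Matrix.dotProduct_mulVec]
      rfl
    rw [Matrix.smul_apply, hs, matB, Matrix.of_apply, ← Matrix.mulVec_mulVec,
      ← Matrix.mulVec_mulVec, Matrix.dotProduct_mulVec θ₀, ← Matrix.mulVec_transpose,
      matPartialDeriv_inv_symm hPs k, Matrix.mulVec_smul, smul_dotProduct, dotProduct_smul]
    simp only [smul_eq_mul, hQ]
    ring
  rw [hB, Matrix.transpose_neg, Matrix.transpose_mul, Matrix.transpose_nonsing_inv, hAs]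
  simp only [Matrix.neg_mul, Matrix.mul_neg, neg_neg, Matrix.mul_smul, Matrix.smul_mul,
    Matrix.mul_assoc]

end PerturbedCost

/-! ### Pathwise linearization of the estimates -/

section Linearization

variable {n p : ℕ}

/-- The pathwise part of the argument: along the indices at which the scaled least squares error
stays bounded, the scaled estimation error is asymptotically a linear function of it. -/
theorem tendsto_linearization {Ω K : Set (EuclideanSpace ℝ (Fin p))} (hΩ : IsOpen Ω)
    {P : EuclideanSpace ℝ (Fin p) → Matrix (Fin n) (Fin n) ℝ}
    (hPpos : ∀ η ∈ Ω, (P η).PosDef)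
    (hPsmooth : ∀ i j, ContDiffOn ℝ 2 (fun η => P η i j) Ω)
    {θ₀ : Fin n → ℝ} {σ : ℝ} (hσ : 0 < σ) {φ : ℕ → Fin n → ℝ} {v : ℕ → ℝ}
    {S : Matrix (Fin n) (Fin n) ℝ} (hS : S.PosDef)
    (hΦ : Tendsto (fun N : ℕ => (N : ℝ)⁻¹ • ((regressionMatrix φ N)ᵀ * regressionMatrix φ N))
      atTop (𝓝 S))
    {η : ℕ → EuclideanSpace ℝ (Fin p)}
    (hη : ∀ᶠ N : ℕ in atTop, η N ∈ argminSet
      (fun e => costEB σ (regressionMatrix φ N) (outputVector θ₀ φ v N) (P e)) Ω)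
    (hKΩ : K ⊆ Ω) (hK : IsCompact K) (hηK : ∀ᶠ N : ℕ in atTop, η N ∈ K)
    {ηb : EuclideanSpace ℝ (Fin p)} (hηb : ηb ∈ argminSet (fun e => limitCost θ₀ (P e)) Ω)
    (hnear : ∀ᶠ N : ℕ in atTop, ∀ e ∈ argminSet (fun e => limitCost θ₀ (P e)) Ω,
      dist (η N) ηb ≤ dist (η N) e)
    (hA : IsUnit (matA θ₀ P ηb).det) (B : ℝ) :
    Tendsto (fun N : ℕ => √(N : ℝ) • (η N - ηb) - WithLp.toLp 2
        (-((matA θ₀ P ηb)⁻¹ * sensitivity θ₀ P ηb) *ᵥ scaledLSError φ v N))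
      (atTop ⊓ 𝓟 {N | ‖(WithLp.toLp 2 (scaledLSError φ v N) : EuclideanSpace ℝ (Fin n))‖ ≤ B})
      (𝓝 0) := by
  set X := scaledLSError φ v with hX
  set F : Filter ℕ := atTop ⊓ 𝓟 {N | ‖(WithLp.toLp 2 (X N) : EuclideanSpace ℝ (Fin n))‖ ≤ B}
    with hF
  have hFtop : F ≤ atTop := inf_le_left
  -- local regularity of the kernel matrix
  have hPd : ∀ e ∈ Ω, ∀ i j, ContDiffAt ℝ 2 (fun y => P y i j) e := fun e he i j =>
    (hPsmooth i j).contDiffAt (hΩ.mem_nhds he)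
  have hdet : ∀ e ∈ Ω, (P e).det ≠ 0 := fun e he => (hPpos e he).det_pos.ne'
  have hev : ∀ᶠ y in 𝓝 ηb, y ∈ Ω := hΩ.mem_nhds hηb.1
  have hPd' := hev.mono hPd
  have hdet' := hev.mono hdet
  have hPs : ∀ᶠ y in 𝓝 ηb, (P y)ᵀ = P y := hev.mono fun y hy => by
    simpa [Matrix.IsHermitian] using (hPpos y hy).isHermitian
  -- boundedness of `X` along `F`
  have hXB : ∀ᶠ N in F, ‖X N‖ ≤ B := by
    have : ∀ᶠ N in F, ‖(WithLp.toLp 2 (X N) : EuclideanSpace ℝ (Fin n))‖ ≤ B :=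
      mem_inf_of_right (mem_principal_self _)
    filter_upwards [this] with N hN
    refine (pi_norm_le_iff_of_nonneg ((norm_nonneg _).trans hN)).2 fun i => ?_
    exact (PiLp.norm_apply_le (WithLp.toLp 2 (X N) : EuclideanSpace ℝ (Fin n)) i).trans hN
  have hXO : X =O[F] fun _ => (1 : ℝ) :=
    Asymptotics.IsBigO.of_bound B (hXB.mono fun N hN => by simpa using hN)
  -- the perturbations of the parameter and of the kernel matrix
  have hsqrt : Tendsto (fun N : ℕ => (√(N : ℝ))⁻¹) atTop (𝓝 0) :=
    tendsto_inv_atTop_zero.comp (Real.tendsto_sqrt_atTop.comp tendsto_natCast_atTop_atTop)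
  have hpos : ∀ᶠ N : ℕ in atTop, 0 < (N : ℝ) :=
    (eventually_gt_atTop 0).mono fun N hN => by exact_mod_cast hN
  let E : ℕ → Fin n → Fin n → ℝ := fun N i j =>
    σ ^ 2 * ((regressionMatrix φ N)ᵀ * regressionMatrix φ N)⁻¹ i j
  have hEof : ∀ N, Matrix.of (E N)
      = σ ^ 2 • ((regressionMatrix φ N)ᵀ * regressionMatrix φ N)⁻¹ := fun N => rfl
  have hsE : Tendsto (fun N : ℕ => √(N : ℝ) • E N) atTop (𝓝 0) := by
    refine tendsto_pi_nhds.2 fun i => tendsto_pi_nhds.2 fun j => ?_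
    have h1 := (hsqrt.mul (tendsto_inv_apply hΦ hS.det_pos.ne' i j)).const_mul (σ ^ 2)
    simp only [zero_mul, mul_zero] at h1
    refine h1.congr' ?_
    filter_upwards [hpos] with N hN
    have h2 : √(N : ℝ) ≠ 0 := (Real.sqrt_pos.2 hN).ne'
    rw [inv_smul_gram]
    simp only [Matrix.smul_apply, Pi.smul_apply, smul_eq_mul, E]
    nth_rewrite 2 [← Real.mul_self_sqrt hN.le]
    field_simp
  have hE : Tendsto E atTop (𝓝 0) := by
    have h1 := hsqrt.smul hsE
    rw [zero_smul] at h1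
    refine h1.congr' ?_
    filter_upwards [hpos] with N hN
    rw [smul_smul, inv_mul_cancel₀ (Real.sqrt_pos.2 hN).ne', one_smul]
  let x : ℕ → (Fin n → ℝ) × (Fin n → Fin n → ℝ) := fun N => (θ₀ + (√(N : ℝ))⁻¹ • X N, E N)
  have hx : Tendsto x F (𝓝 (θ₀, 0)) := by
    refine Tendsto.prodMk_nhds ?_ (hE.mono_left hFtop)
    have h1 : Tendsto (fun N : ℕ => (√(N : ℝ))⁻¹ • X N) F (𝓝 0) :=
      (hsqrt.mono_left hFtop).zero_smul_isBoundedUnder_le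
        (isBoundedUnder_of_eventually_le (a := B) hXB)
    simpa using h1.const_add θ₀
  have hsx : ∀ᶠ N : ℕ in atTop, √(N : ℝ) • (x N - (θ₀, 0)) = (X N, √(N : ℝ) • E N) := by
    filter_upwards [hpos] with N hN
    simp only [x, Prod.mk_sub_mk, add_sub_cancel_left, sub_zero, Prod.smul_mk, smul_smul]
    rw [mul_inv_cancel₀ (Real.sqrt_pos.2 hN).ne', one_smul]
  -- the estimates minimize the perturbed limit cost
  have hG : ∀ᶠ N : ℕ in atTop,
      IsUnit ((regressionMatrix φ N)ᵀ * regressionMatrix φ N).det := by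
    have h1 : Tendsto (fun N : ℕ =>
        ((N : ℝ)⁻¹ • ((regressionMatrix φ N)ᵀ * regressionMatrix φ N)).det) atTop (𝓝 S.det) :=
      ((Continuous.matrix_det continuous_id).tendsto S).comp hΦ
    filter_upwards [h1.eventually_ne hS.det_pos.ne'] with N hN
    rw [Matrix.det_smul] at hN
    exact isUnit_iff_ne_zero.2 (right_ne_zero_of_mul hN)
  have hmin : ∀ᶠ N in F, η N ∈ argminSet (fun e => perturbedCost P (x N, e)) Ω := by
    filter_upwards [hη.filter_mono hFtop, hG.filter_mono hFtop, hpos.filter_mono hFtop]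
      with N hN hGN hN0
    obtain ⟨c, hc⟩ := costEB_eq hσ.ne' (regressionMatrix φ N) (outputVector θ₀ φ v N) hGN
    have hθ : θ₀ + (√(N : ℝ))⁻¹ • X N
        = ((regressionMatrix φ N)ᵀ * regressionMatrix φ N)⁻¹ *ᵥ
          ((regressionMatrix φ N)ᵀ *ᵥ outputVector θ₀ φ v N) := by
      rw [leastSquares_outputVector θ₀ φ v N hGN, hX, scaledLSError, smul_smul,
        inv_mul_cancel₀ (Real.sqrt_pos.2 hN0).ne', one_smul]
    have hcost : ∀ e ∈ Ω, costEB σ (regressionMatrix φ N) (outputVector θ₀ φ v N) (P e)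
        = c + perturbedCost P (x N, e) := by
      intro e he
      have hpsd : (σ ^ 2 • ((regressionMatrix φ N)ᵀ * regressionMatrix φ N)⁻¹).PosSemidef := by
        have := (Matrix.posSemidef_conjTranspose_mul_self (regressionMatrix φ N)).inv.smul
          (sq_nonneg σ)
        rwa [Matrix.conjTranspose_eq_transpose_of_trivial] at this
      rw [hc (P e) ((hPpos e he).add_posSemidef hpsd).det_pos.ne', ← hθ]
      rfl
    refine ⟨hN.1, fun e he => ?_⟩
    have h1 := hN.2 e he
    simp only [hcost _ hN.1, hcost e he] at h1
    exact le_of_add_le_add_left h1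
  -- consistency
  have hηlim : Tendsto η F (𝓝 ηb) := by
    refine tendsto_argmin (w := perturbedCost P) (x₀ := (θ₀, 0)) (fun e he =>
      (contDiffAt_perturbedCost (hPd e he) (hdet e he) θ₀).continuousAt) hx hKΩ hK
      (hηK.filter_mono hFtop) hmin ?_
    simp only [perturbedCost_zero]
    exact hnear.filter_mono hFtop
  -- first-order conditions
  have hcd := contDiffAt_perturbedCost hPd'.self_of_nhds hdet'.self_of_nhds θ₀
  have hlocal : ∀ {f : EuclideanSpace ℝ (Fin p) → ℝ} {e}, e ∈ argminSet f Ω → IsLocalMin f e :=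
    fun he => (hΩ.mem_nhds he.1 : Ω ∈ 𝓝 _) |> fun h => Filter.mem_of_superset h he.2
  have hdiffev : ∀ᶠ y in 𝓝 ((θ₀, 0), ηb), DifferentiableAt ℝ (perturbedCost P) y :=
    (hcd.eventually (by simp)).mono fun y hy => hy.differentiableAt (by norm_num)
  have hroot : ∀ᶠ N in F, score P (x N, η N) = 0 := by
    filter_upwards [hmin, (hx.prodMk_nhds hηlim).eventually hdiffev] with N hN hdN
    exact score_eq_zero_of_isLocalMin hdN (hlocal hN)
  have hroot0 : score P ((θ₀, 0), ηb) = 0 := by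
    refine score_eq_zero_of_isLocalMin (hcd.differentiableAt (by norm_num)) ?_
    simp only [perturbedCost_zero]
    exact hlocal hηb
  -- expansion of the score
  obtain ⟨L, hL, hLη, hLθ⟩ := exists_hasFDerivAt_score hPd' hdet' hPs θ₀
  set C := L.comp (ContinuousLinearMap.inl ℝ _ _) with hC
  have hLsum : ∀ ξ ζ, L (ξ, ζ) = C ξ + mulVecEquiv (matA θ₀ P ηb) hA ζ := by
    intro ξ ζ
    rw [mulVecEquiv_apply, ← hLη, hC, ContinuousLinearMap.comp_apply,
      ContinuousLinearMap.inl_apply, ← map_add]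
    simp
  have hexp := isLittleO_root_expansion C (mulVecEquiv (matA θ₀ P ηb) hA) hLsum hL hroot0 hx
    hηlim hroot
  have hscaled : (fun N : ℕ => √(N : ℝ) • (η N - ηb
      + (mulVecEquiv (matA θ₀ P ηb) hA).symm (C (x N - (θ₀, 0))))) =o[F] fun _ => (1 : ℝ) := by
    refine ((Asymptotics.isBigO_refl (fun N : ℕ => √(N : ℝ)) F).smul_isLittleO hexp).trans_isBigO ?_
    refine (Asymptotics.IsBigO.prod_left hXO
      ((hsE.mono_left hFtop).isBigO_one ℝ)).congr' ?_ EventuallyEq.rfl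
    filter_upwards [hsx.filter_mono hFtop] with N hN using hN.symm
  have hCE : Tendsto (fun N : ℕ => (mulVecEquiv (matA θ₀ P ηb) hA).symm
      (C ((0 : Fin n → ℝ), √(N : ℝ) • E N))) F (𝓝 0) := by
    have h1 : Tendsto (fun N : ℕ => ((0 : Fin n → ℝ), √(N : ℝ) • E N)) F (𝓝 0) :=
      tendsto_const_nhds.prodMk_nhds (hsE.mono_left hFtop)
    have h2 := (((mulVecEquiv (matA θ₀ P ηb) hA).symm.continuous.comp C.continuous).tendsto
      0).comp h1
    simpa [Function.comp_def] using h2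
  have hdiff := ((Asymptotics.isLittleO_one_iff ℝ).1 hscaled).sub hCE
  rw [sub_zero] at hdiff
  refine hdiff.congr' ?_
  filter_upwards [hsx.filter_mono hFtop] with N hN
  have h1 : C (X N, √(N : ℝ) • E N)
      = sensitivity θ₀ P ηb *ᵥ X N + C ((0 : Fin n → ℝ), √(N : ℝ) • E N) := by
    have h2 : C (X N, 0) = sensitivity θ₀ P ηb *ᵥ X N := hLθ (X N)
    rw [← h2, ← map_add]
    simp
  rw [smul_add, ← map_smul, ← map_smul, hN, h1, map_add, mulVecEquiv_symm_apply,
    Matrix.mulVec_mulVec, Matrix.neg_mulVec, WithLp.toLp_neg]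
  abel

end Linearization

/-! ### Convergence in probability on bounded events -/

section Slutsky

variable {𝓢 : Type*} [MeasurableSpace 𝓢] {μ : Measure 𝓢} [IsProbabilityMeasure μ]

/-- If `R N → 0` almost surely along the indices at which `Z N` stays bounded, for every bound, and
`Z` is bounded in probability, then `R N → 0` in probability. -/
theorem tendstoInMeasure_of_isTight {E E' : Type*} [NormedAddCommGroup E] [MeasurableSpace E]
    [BorelSpace E] [SecondCountableTopology E] [NormedAddCommGroup E'] [MeasurableSpace E']
    [BorelSpace E'] [ProperSpace E'] {R : ℕ → 𝓢 → E} {Z : ℕ → 𝓢 → E'}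
    (hR : ∀ N, AEMeasurable (R N) μ) (hZ : ∀ N, AEMeasurable (Z N) μ)
    (htight : IsTightMeasureSet (Set.range fun N => μ.map (Z N)))
    (h : ∀ᵐ ω ∂μ, ∀ B : ℝ,
      Tendsto (fun N => R N ω) (atTop ⊓ 𝓟 {N | ‖Z N ω‖ ≤ B}) (𝓝 0)) :
    TendstoInMeasure μ R atTop 0 := by
  rw [tendstoInMeasure_iff_norm]
  intro ε hε
  rw [ENNReal.tendsto_nhds_zero]
  intro δ hδ
  have hδ2 : 0 < δ / 2 := ENNReal.half_pos hδ.ne'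
  have ht := isTightMeasureSet_iff_tendsto_measure_norm_gt.1 htight
  obtain ⟨B, hB⟩ := (ENNReal.tendsto_nhds_zero.1 ht (δ / 2) hδ2).exists
  rw [iSup_range] at hB
  have hZB : ∀ N, μ {ω | B < ‖Z N ω‖} ≤ δ / 2 := by
    intro N
    refine le_trans (le_of_eq ?_) ((le_iSup (fun N => (μ.map (Z N)) {x | B < ‖x‖}) N).trans hB)
    rw [Measure.map_apply_of_aemeasurable (hZ N)
      (measurableSet_lt measurable_const measurable_norm)]
    rfl
  -- truncate `R` to the event on which `Z` is bounded by `B`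
  have hset : ∀ N, NullMeasurableSet {ω | ‖Z N ω‖ ≤ B} μ := fun N =>
    nullMeasurableSet_le (hZ N).norm aemeasurable_const
  have htrunc : TendstoInMeasure μ (fun N => {ω | ‖Z N ω‖ ≤ B}.indicator (R N)) atTop
      (fun _ => 0) := by
    refine tendstoInMeasure_of_tendsto_ae
      (fun N => (hR N).aestronglyMeasurable.indicator₀ (hset N)) ?_
    filter_upwards [h] with ω hω
    have h1 := hω B
    rw [Metric.tendsto_nhds] at h1 ⊢
    intro r hr
    have h2 := h1 r hr
    rw [eventually_inf_principal] at h2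
    filter_upwards [h2] with N hN
    by_cases hmem : ‖Z N ω‖ ≤ B
    · simpa [Set.indicator, hmem] using hN hmem
    · simpa [Set.indicator, hmem] using hr
  rw [tendstoInMeasure_iff_norm] at htrunc
  filter_upwards [ENNReal.tendsto_nhds_zero.1 (htrunc ε hε) (δ / 2) hδ2] with N hN
  calc μ {ω | ε ≤ ‖R N ω - (0 : 𝓢 → E) ω‖}
      ≤ μ ({ω | ε ≤ ‖{ω | ‖Z N ω‖ ≤ B}.indicator (R N) ω - 0‖} ∪ {ω | B < ‖Z N ω‖}) := by
        refine measure_mono fun ω hω => ?_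
        by_cases hmem : ‖Z N ω‖ ≤ B
        · left
          simpa [Set.indicator, hmem] using hω
        · right
          exact not_le.1 hmem
    _ ≤ δ / 2 + δ / 2 := (measure_union_le _ _).trans (add_le_add hN (hZB N))
    _ = δ := ENNReal.add_halves δ

end Slutsky

end EmpiricalBayes

end

/-! ### Asymptotic normality of the empirical Bayes estimate -/

theorem theorem3
    {n p : ℕ}
    -- hyper-parameter domain and kernel matrix
    (Ω : Set (EuclideanSpace ℝ (Fin p))) (hΩ : IsOpen Ω)
    (P : EuclideanSpace ℝ (Fin p) → Matrix (Fin n) (Fin n) ℝ)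
    (hPpos : ∀ η ∈ Ω, (P η).PosDef)
    (hPsmooth : ∀ i j, ContDiffOn ℝ 2 (fun η => P η i j) Ω)
    -- linear regression model with Gaussian white noise
    {𝓢 : Type*} [MeasurableSpace 𝓢] (μ : Measure 𝓢) [IsProbabilityMeasure μ]
    (θ₀ : Fin n → ℝ) (σ : ℝ) (hσ : 0 < σ)
    (φ : ℕ → 𝓢 → Fin n → ℝ) (hφ : ∀ t, Measurable (φ t))
    (v : ℕ → 𝓢 → ℝ) (hv : ∀ t, Measurable (v t))
    (hvlaw : ∀ t, HasLaw (v t) (gaussianReal 0 (Real.toNNReal (σ ^ 2))) μ)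
    (hvindep : iIndepFun v μ)
    (hφv : IndepFun (fun ω t => φ t ω) (fun ω t => v t ω) μ)
    -- `ΦᵀΦ / N → Σ ≻ 0` almost surely
    (S : Matrix (Fin n) (Fin n) ℝ) (hS : S.PosDef)
    (hΦ : ∀ᵐ ω ∂μ, Tendsto
      (fun N : ℕ => (N : ℝ)⁻¹ •
        ((EmpiricalBayes.regressionMatrix (fun t => φ t ω) N)ᵀ *
          EmpiricalBayes.regressionMatrix (fun t => φ t ω) N)) atTop (𝓝 S))
    -- the empirical Bayes estimates minimize the cost over `Ω`
    (ηEB : ℕ → 𝓢 → EuclideanSpace ℝ (Fin p)) (hmeas : ∀ N, AEMeasurable (ηEB N) μ)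
    (hEB : ∀ᵐ ω ∂μ, ∀ᶠ N : ℕ in atTop,
      ηEB N ω ∈ EmpiricalBayes.argminSet
        (fun η => EmpiricalBayes.costEB σ
          (EmpiricalBayes.regressionMatrix (fun t => φ t ω) N)
          (EmpiricalBayes.outputVector θ₀ (fun t => φ t ω) (fun t => v t ω) N) (P η)) Ω)
    -- and stay in the interior of `Ω`, away from its boundary and from infinity
    (hinterior : ∀ᵐ ω ∂μ, ∃ K ⊆ Ω, IsCompact K ∧ ∀ᶠ N : ℕ in atTop, ηEB N ω ∈ K)
    -- `ηb` minimizes the limit cost, whose minimizers are isolated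
    (ηb : EuclideanSpace ℝ (Fin p))
    (hηb : ηb ∈ EmpiricalBayes.argminSet (fun η => EmpiricalBayes.limitCost θ₀ (P η)) Ω)
    (hisolated : ∀ η ∈ EmpiricalBayes.argminSet (fun η => EmpiricalBayes.limitCost θ₀ (P η)) Ω,
      ∃ U ∈ 𝓝 η,
        U ∩ EmpiricalBayes.argminSet (fun η => EmpiricalBayes.limitCost θ₀ (P η)) Ω = {η})
    -- if there are several, `ηb` is the one next to the estimates
    (hnearest : ∀ᵐ ω ∂μ, ∀ᶠ N : ℕ in atTop,
      ∀ η ∈ EmpiricalBayes.argminSet (fun η => EmpiricalBayes.limitCost θ₀ (P η)) Ω,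
        dist (ηEB N ω) ηb ≤ dist (ηEB N ω) η)
    (hA : IsUnit (EmpiricalBayes.matA θ₀ P ηb).det) :
    -- `A_b` is the Hessian of `W_b`
    (∀ k l, EmpiricalBayes.matA θ₀ P ηb k l =
      EmpiricalBayes.partialDeriv k (EmpiricalBayes.partialDeriv l
        (fun η => EmpiricalBayes.limitCost θ₀ (P η))) ηb) ∧
    ((EmpiricalBayes.matA θ₀ P ηb)⁻¹ * EmpiricalBayes.matB σ S θ₀ P ηb *
      (EmpiricalBayes.matA θ₀ P ηb)⁻¹).PosSemidef ∧
    TendstoInDistribution (fun (N : ℕ) ω => √(N : ℝ) • (ηEB N ω - ηb)) atTop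
      (id : EuclideanSpace ℝ (Fin p) → EuclideanSpace ℝ (Fin p)) (fun _ => μ)
      (multivariateGaussian 0
        ((EmpiricalBayes.matA θ₀ P ηb)⁻¹ * EmpiricalBayes.matB σ S θ₀ P ηb *
          (EmpiricalBayes.matA θ₀ P ηb)⁻¹)) := by
  have hev : ∀ᶠ y in 𝓝 ηb, y ∈ Ω := hΩ.mem_nhds hηb.1
  have hPd : ∀ᶠ y in 𝓝 ηb, ∀ i j, ContDiffAt ℝ 2 (fun y => P y i j) y := hev.mono fun e he i j =>
    (hPsmooth i j).contDiffAt (hΩ.mem_nhds he)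
  have hdet : ∀ᶠ y in 𝓝 ηb, (P y).det ≠ 0 := hev.mono fun e he => (hPpos e he).det_pos.ne'
  have hPs : ∀ᶠ y in 𝓝 ηb, (P y)ᵀ = P y := hev.mono fun y hy => by
    simpa [Matrix.IsHermitian] using (hPpos y hy).isHermitian
  set M := -((EmpiricalBayes.matA θ₀ P ηb)⁻¹ * EmpiricalBayes.sensitivity θ₀ P ηb) with hM
  have hcov : σ ^ 2 • (M * S⁻¹ * Mᵀ) = (EmpiricalBayes.matA θ₀ P ηb)⁻¹
      * EmpiricalBayes.matB σ S θ₀ P ηb * (EmpiricalBayes.matA θ₀ P ηb)⁻¹ :=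
    EmpiricalBayes.sensitivity_covariance (EmpiricalBayes.matA_symm hPd hdet θ₀) hPs σ S
  refine ⟨EmpiricalBayes.matA_eq_hessian hPd hdet θ₀, ?_, ?_⟩
  · rw [← hcov]
    have := (hS.inv.posSemidef.mul_mul_conjTranspose_same M).smul (sq_nonneg σ)
    rwa [Matrix.conjTranspose_eq_transpose_of_trivial] at this
  · rw [← hcov]
    have hlin := EmpiricalBayes.tendstoInDistribution_scaledLSError hφ hv hvlaw hvindep hφv hS hΦ M
    have hLS := EmpiricalBayes.tendstoInDistribution_scaledLSError hφ hv hvlaw hvindep hφv hS hΦ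
      (1 : Matrix (Fin n) (Fin n) ℝ)
    simp only [Matrix.one_mulVec] at hLS
    have hmeas' : ∀ N : ℕ, AEMeasurable (fun ω => √(N : ℝ) • (ηEB N ω - ηb)) μ := fun N =>
      ((hmeas N).sub_const ηb).fun_const_smul _
    -- the scaled error differs from its linearization by a term that tends to `0` in probability
    refine tendstoInDistribution_of_tendstoInMeasure_sub _ _ hlin ?_ hmeas'
    refine EmpiricalBayes.tendstoInMeasure_of_isTight
      (fun N => (hmeas' N).sub (hlin.forall_aemeasurable N)) hLS.forall_aemeasurable
      (EmpiricalBayes.isTightMeasureSet_of_tendstoInDistribution hLS) ?_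
    filter_upwards [hΦ, hEB, hinterior, hnearest] with ω hΦω hEBω hKω hnearω
    obtain ⟨K, hKΩ, hK, hηK⟩ := hKω
    exact EmpiricalBayes.tendsto_linearization hΩ hPpos hPsmooth hσ hS hΦω hEBω hKΩ hK hηK hηb
      hnearω hA
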